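/- Let $\psi : \mathbb{N} = \{1,2,3,\dots\} \to \mathbb{R}$ be a non-negative function. For $n \ge 1$ let $\mathcal{E}_n \subset \mathbb{R}/\mathbb{Z}$ be the image modulo $1$ of $$\bigcup_{\substack{1 \le a \le n,\\ \gcd(a,n)=1}} \left( \frac{a-\psi(n)}{n}, \frac{a+\psi(n)}{n} \right),$$ and let $W(\psi) = \bigcap_{N=1}^\infty \bigcup_{n=N}^\infty \mathcal{E}_n$. For $h \ge 1$ put $$\Delta_h = \left\{ 2^{2^h}+1, \dots, 2^{2^{h+1}} \right\}, \qquad S_h = \sum_{n \in \Delta_h} \frac{\psi(n)\varphi(n)}{n},$$ where $\varphi$ is Euler's totient function. If $$\sum_{h=1}^\infty \min(S_h, 1/h) = \infty,$$ then $\lambda(W(\psi)) = 1$, where $\lambda$ is Lebesgue measure on $\mathbb{R}/\mathbb{Z}$ (of total mass $1$). -/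

import Mathlib

open MeasureTheory Filter

namespace DuffinSchaeffer

noncomputable section

/-- The set `E_n ⊆ ℝ/ℤ`: the union, over `1 ≤ a ≤ n` with `gcd(a, n) = 1`, of the images in `ℝ/ℤ`
of the open intervals `((a - ψ(n))/n, (a + ψ(n))/n)`. -/
def E (ψ : ℕ → ℝ) (n : ℕ) : Set (AddCircle (1 : ℝ)) :=
  ⋃ a ∈ {a : ℕ | 1 ≤ a ∧ a ≤ n ∧ Nat.gcd a n = 1},
    (fun x : ℝ => (x : AddCircle (1 : ℝ))) ''
      Set.Ioo (((a : ℝ) - ψ n) / (n : ℝ)) (((a : ℝ) + ψ n) / (n : ℝ))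

/-- The limsup set `W(ψ) = ⋂_{N ≥ 1} ⋃_{n ≥ N} E_n`. -/
def W (ψ : ℕ → ℝ) : Set (AddCircle (1 : ℝ)) :=
  ⋂ N : ℕ, ⋂ _ : 1 ≤ N, ⋃ n : ℕ, ⋃ _ : N ≤ n, E ψ n

/-- The block `Δ_h = {2^(2^h) + 1, …, 2^(2^(h+1))}`. -/
def Δ (h : ℕ) : Finset ℕ :=
  Finset.Icc (2 ^ (2 ^ h) + 1) (2 ^ (2 ^ (h + 1)))

/-- The block sum `S_h = ∑_{n ∈ Δ_h} ψ(n) φ(n) / n`, with `φ` Euler's totient function. -/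
def S (ψ : ℕ → ℝ) (h : ℕ) : ℝ :=
  ∑ n ∈ Δ h, ψ n * (Nat.totient n : ℝ) / (n : ℝ)

end

end DuffinSchaeffer

/-!
The proof shows directly that every tail union `⋃_{n > N} E ψ n` has full measure; no zero-one law
is used.

*Overlaps.* For distinct `m, n` with `d = gcd(m, n)`, `m = d m'`, `n = d n'`, the measure of
`E ψ m ∩ E ψ n` is governed by the number of pairs of reduced residues `a` mod `m`, `b` mod `n` with
`a n' - b m' = k`, for small `k ≠ 0`. These pairs lie on a line, and the Chinese remainder theorem
bounds their number (`card_reducedPairs_le`) by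
`d · (l / φ(l)) · (φ(m) / m) · (φ(n) / n) · (|k| / φ(|k|))` with `l = m' n'`. As `k / φ(k)` is bounded
on average, `E ψ m` and `E ψ n` are quasi-independent up to the factor `l / φ(l) = O(log log (m n))`
(`measure_inter_le`), which is `O(h)` inside the block `Δ h`; the exact power of `h` comes from
Mertens' bound `prod_primesLE_le`. If `ψ` is scaled down on `Δ h` so that the block sum becomes
`σ = min (S ψ h) (κ / h)`, then the overlaps inside the block add up to `O(h σ²) = O(κ σ)`, which is
negligible for small `κ`.

*Equidistribution.* The union of the blocks `Δ g` with `g ≤ h - 4` has few end points compared with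
the size of any `n ∈ Δ h`, since `n` exceeds the eighth power of all the earlier denominators. By
Legendre's sieve each `E ψ n` meets the complement `U` of that union in its fair share, up to a
constant (`measure_compl_inter_ge`).

*Conclusion.* Suppose that a tail union misses a set of measure `δ > 0`. By Bonferroni's inequality
the block `Δ h` then covers a part of `U` of measure at least `(δ / 4) σ` (`measure_block_ge`). The
parts belonging to indices `h` at least `4` apart are disjoint, so the sum of their measures is at
most `4`, and `∑ min (S ψ h) (1 / h)` converges (`exists_sum_min_le`).
-/

open MeasureTheory Filter

namespace DuffinSchaeffer

/-! ### Mertens' upper bound and the size of `n / φ(n)` -/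

/-- Chebyshev's argument: `p ^ ⌊n / p⌋ ∣ n!` for each prime `p ≤ n`, and `log n! ≤ n log n`. -/
theorem sum_primesLE_log_div_le (n : ℕ) :
    ∑ p ∈ Nat.primesLE n, Real.log p / p ≤ 2 * Real.log n := by
  rcases Nat.eq_zero_or_pos n with rfl | hn
  · simp
  have hn' : (0 : ℝ) < n := by exact_mod_cast hn
  have hdvd : ∏ p ∈ Nat.primesLE n, p ^ (n / p) ∣ n.factorial := by
    apply Finset.prod_dvd_of_isRelPrime
    · intro p hp q hq hpq
      exact Nat.coprime_iff_isRelPrime.1 (Nat.Coprime.pow _ _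
        ((Nat.coprime_primes (Nat.prime_of_mem_primesLE hp) (Nat.prime_of_mem_primesLE hq)).2 hpq))
    · intro p hp
      have hp' := Nat.prime_of_mem_primesLE hp
      rw [hp'.pow_dvd_factorial_iff (Nat.lt_succ_self _)]
      have hpn : p ≤ n := Nat.le_of_mem_primesLE hp
      have : 1 ∈ Finset.Ico 1 (Nat.log p n).succ := by
        simp [Nat.log_pos hp'.one_lt hpn]
      refine le_trans (by simp) (Finset.single_le_sum (f := fun i => n / p ^ i) (by simp) this)
  have hle : (∏ p ∈ Nat.primesLE n, p ^ (n / p)) ≤ n ^ n :=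
    (Nat.le_of_dvd (Nat.factorial_pos n) hdvd).trans (Nat.factorial_le_pow n)
  have hlog : ∑ p ∈ Nat.primesLE n, ((n / p : ℕ) : ℝ) * Real.log p ≤ n * Real.log n := by
    have h1 : Real.log ((∏ p ∈ Nat.primesLE n, p ^ (n / p) : ℕ) : ℝ) ≤
        Real.log ((n ^ n : ℕ) : ℝ) := by
      apply Real.log_le_log
      · have : 0 < ∏ p ∈ Nat.primesLE n, p ^ (n / p) :=
          Finset.prod_pos fun p hp => pow_pos (Nat.prime_of_mem_primesLE hp).pos _
        exact_mod_cast this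
      · exact_mod_cast hle
    push_cast at h1
    rw [Real.log_prod, Real.log_pow] at h1
    · simpa only [Real.log_pow] using h1
    · intro p hp
      have := (Nat.prime_of_mem_primesLE hp).pos
      positivity
  have hterm : ∀ p ∈ Nat.primesLE n,
      (n : ℝ) * (Real.log p / p) ≤ 2 * (((n / p : ℕ) : ℝ) * Real.log p) := by
    intro p hp
    have hp' := Nat.prime_of_mem_primesLE hp
    have hpn : p ≤ n := Nat.le_of_mem_primesLE hp
    have hp0 : (0 : ℝ) < p := by exact_mod_cast hp'.pos
    have hl : 0 ≤ Real.log p := Real.log_natCast_nonneg p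
    have h1 : 1 ≤ n / p := (Nat.one_le_div_iff hp'.pos).2 hpn
    have h2 : n < p * (n / p + 1) := Nat.lt_mul_div_succ n hp'.pos
    have h3 : (n : ℝ) / p ≤ 2 * ((n / p : ℕ) : ℝ) := by
      rw [div_le_iff₀ hp0]
      have : n ≤ 2 * (n / p) * p := by nlinarith
      exact_mod_cast this
    calc (n : ℝ) * (Real.log p / p) = n / p * Real.log p := by ring
      _ ≤ 2 * ((n / p : ℕ) : ℝ) * Real.log p := by gcongr
      _ = _ := by ring
  have := Finset.sum_le_sum hterm
  rw [← Finset.mul_sum, ← Finset.mul_sum] at this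
  have h4 : (n : ℝ) * ∑ p ∈ Nat.primesLE n, Real.log p / p ≤ n * (2 * Real.log n) := by linarith
  exact le_of_mul_le_mul_left h4 hn'

theorem tsum_natCast_rpow_neg_le {s : ℝ} (hs : 1 < s) :
    ∑' n : ℕ, (n : ℝ) ^ (-s) ≤ 1 + 1 / (s - 1) := by
  have h := ZetaAsymptotics.zeta_limit_aux1 hs
  have hnn : 0 ≤ ZetaAsymptotics.termTSum s :=
    tsum_nonneg fun n => ZetaAsymptotics.term_nonneg _ _
  have hsum : Summable fun n : ℕ => (n : ℝ) ^ (-s) := Real.summable_nat_rpow.2 (by linarith)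
  rw [hsum.tsum_eq_zero_add]
  have h0 : ((0 : ℕ) : ℝ) ^ (-s) = 0 := by
    simp [Real.zero_rpow (show -s ≠ 0 by linarith)]
  rw [h0, zero_add]
  have : ∀ n : ℕ, (((n + 1 : ℕ) : ℝ)) ^ (-s) = 1 / (n + 1 : ℝ) ^ s := by
    intro n
    rw [Real.rpow_neg (by positivity)]
    push_cast
    simp
  simp_rw [this]
  nlinarith

/-- Euler product bound: over the primes up to `n`, the product is a partial sum of `ζ(s)`. -/
theorem prod_primesLE_rpow_le {s : ℝ} (hs : 1 < s) (n : ℕ) :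
    ∏ p ∈ Nat.primesLE n, (1 - (p : ℝ) ^ (-s))⁻¹ ≤ 1 + 1 / (s - 1) := by
  let f : ℕ →* ℝ :=
    { toFun := fun n => (n : ℝ) ^ (-s)
      map_one' := by simp
      map_mul' := fun a b => by
        push_cast
        exact Real.mul_rpow (by positivity) (by positivity) }
  have hsum : Summable f := Real.summable_nat_rpow.2 (by linarith)
  have h := EulerProduct.prod_primesBelow_geometric_eq_tsum_smoothNumbers hsum (n + 1)
  have h2 : ∑' m : (n + 1).smoothNumbers, f m ≤ ∑' m, f m :=
    hsum.tsum_subtype_le f _ fun m => Real.rpow_nonneg (Nat.cast_nonneg m) _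
  exact (h.le.trans h2).trans (tsum_natCast_rpow_neg_le hs)

/-- Mertens' upper bound. The Euler factors at `1` and at `σ = 1 + 1 / log n` differ by
`exp (O(log p / (p log n)))`, which multiplies up to a constant. -/
theorem prod_primesLE_le {n : ℕ} (hn : 2 ≤ n) :
    ∏ p ∈ Nat.primesLE n, (1 - (p : ℝ)⁻¹)⁻¹ ≤ Real.exp 4 * (1 + Real.log n) := by
  have hlog : 0 < Real.log n := Real.log_pos (by exact_mod_cast hn)
  set ε : ℝ := 1 / Real.log n with hε
  have hε0 : 0 < ε := by positivity
  have hfac : ∀ p ∈ Nat.primesLE n, (1 - (p : ℝ)⁻¹)⁻¹ ≤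
      Real.exp (2 * ε * (Real.log p / p)) * (1 - (p : ℝ) ^ (-(1 + ε)))⁻¹ := by
    intro p hp
    have hp2 : (2 : ℝ) ≤ p := by exact_mod_cast (Nat.prime_of_mem_primesLE hp).two_le
    have hp0 : (0 : ℝ) < p := by linarith
    have hinv : (p : ℝ)⁻¹ ≤ 1 / 2 := by
      rw [inv_eq_one_div]; exact one_div_le_one_div_of_le two_pos hp2
    have hsplit : (p : ℝ) ^ (-(1 + ε)) = (p : ℝ)⁻¹ * Real.exp (-(ε * Real.log p)) := by
      rw [neg_add, Real.rpow_add hp0, Real.rpow_neg_one, Real.rpow_def_of_pos hp0]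
      congr 2; ring
    have hexp : 1 - ε * Real.log p ≤ Real.exp (-(ε * Real.log p)) := by
      have := Real.add_one_le_exp (-(ε * Real.log p)); linarith
    have hl : 0 < Real.log p := Real.log_pos (by linarith)
    have hexp1 : Real.exp (-(ε * Real.log p)) ≤ 1 := by
      rw [Real.exp_le_one_iff]; nlinarith
    have hpi : 0 < (p : ℝ)⁻¹ := by positivity
    have hσ : (p : ℝ) ^ (-(1 + ε)) ≤ (p : ℝ)⁻¹ := by rw [hsplit]; nlinarith
    have hpos : 0 < 1 - (p : ℝ) ^ (-(1 + ε)) := by linarith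
    have hpos' : 0 < 1 - (p : ℝ)⁻¹ := by linarith
    rw [← div_eq_mul_inv, inv_eq_one_div, div_le_div_iff₀ hpos' hpos, one_mul, hsplit]
    have hE := Real.add_one_le_exp (2 * ε * (Real.log p / p))
    have hx : 0 ≤ ε * Real.log p * (p : ℝ)⁻¹ := by positivity
    calc 1 - (p : ℝ)⁻¹ * Real.exp (-(ε * Real.log p))
        ≤ 1 - (p : ℝ)⁻¹ * (1 - ε * Real.log p) := by gcongr
      _ ≤ (2 * ε * (Real.log p / p) + 1) * (1 - (p : ℝ)⁻¹) := by
          rw [div_eq_mul_inv]; nlinarith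
      _ ≤ _ := by gcongr
  calc ∏ p ∈ Nat.primesLE n, (1 - (p : ℝ)⁻¹)⁻¹
      ≤ ∏ p ∈ Nat.primesLE n,
          (Real.exp (2 * ε * (Real.log p / p)) * (1 - (p : ℝ) ^ (-(1 + ε)))⁻¹) := by
        refine Finset.prod_le_prod (fun p hp => ?_) hfac
        have : (1 : ℝ) ≤ p := by exact_mod_cast (Nat.prime_of_mem_primesLE hp).one_le
        exact inv_nonneg.2 (sub_nonneg.2 (inv_le_one_of_one_le₀ this))
    _ = Real.exp (2 * ε * ∑ p ∈ Nat.primesLE n, Real.log p / p) *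
          ∏ p ∈ Nat.primesLE n, (1 - (p : ℝ) ^ (-(1 + ε)))⁻¹ := by
        rw [Finset.prod_mul_distrib, ← Real.exp_sum, Finset.mul_sum]
    _ ≤ Real.exp (2 * ε * (2 * Real.log n)) * (1 + 1 / (1 + ε - 1)) := by
        gcongr
        · refine Finset.prod_nonneg fun p hp => ?_
          have : (1 : ℝ) ≤ p := by exact_mod_cast (Nat.prime_of_mem_primesLE hp).one_le
          exact inv_nonneg.2 (sub_nonneg.2 (Real.rpow_le_one_of_one_le_of_nonpos this (by linarith)))
        · exact sum_primesLE_log_div_le n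
        · exact prod_primesLE_rpow_le (by linarith) n
    _ = _ := by
        have h1 : 2 * ε * (2 * Real.log n) = 4 := by rw [hε]; field_simp; norm_num
        have h2 : 1 / (1 + ε - 1) = Real.log n := by rw [hε]; field_simp; simp
        rw [h1, h2]

theorem div_totient_eq_prod {n : ℕ} (hn : n ≠ 0) :
    (n : ℝ) / n.totient = ∏ p ∈ n.primeFactors, (1 - (p : ℝ)⁻¹)⁻¹ := by
  have h : ((n.totient : ℚ) : ℝ) = ((n * ∏ p ∈ n.primeFactors, (1 - (p : ℚ)⁻¹) : ℚ) : ℝ) := by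
    rw [Nat.totient_eq_mul_prod_factors]
  push_cast at h
  rw [h, Finset.prod_inv_distrib, div_mul_eq_div_div, div_self (by exact_mod_cast hn), one_div]

theorem totient_div_eq_prod {n : ℕ} (hn : n ≠ 0) :
    (n.totient : ℝ) / n = ∏ p ∈ n.primeFactors, (1 - (p : ℝ)⁻¹) := by
  rw [← inv_div, div_totient_eq_prod hn, Finset.prod_inv_distrib, inv_inv]

/-- `n / φ(n) = O(log log n)`. The at most `2 ^ j` prime factors above `2 ^ j` contribute at most
`(1 + 2 ^ (-j)) ^ (2 ^ j) ≤ e`; those below are covered by Mertens' bound. -/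
theorem div_totient_le {n j : ℕ} (hn : n ≠ 0) (hj : 1 ≤ j) (hnj : n ≤ 2 ^ 2 ^ j) :
    (n : ℝ) / n.totient ≤ Real.exp 5 * (1 + j) := by
  rw [div_totient_eq_prod hn, ← Finset.prod_filter_mul_prod_filter_not _ (fun p => p ≤ 2 ^ j)]
  have hfac1 : ∀ p : ℕ, p.Prime → 1 ≤ (1 - (p : ℝ)⁻¹)⁻¹ := by
    intro p hp
    have hp2 : (1 : ℝ) < p := by exact_mod_cast hp.one_lt
    have := inv_lt_one_of_one_lt₀ hp2
    exact (one_le_inv₀ (by linarith)).2 (by simp)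
  have hsmall : ∏ p ∈ n.primeFactors with p ≤ 2 ^ j, (1 - (p : ℝ)⁻¹)⁻¹
      ≤ Real.exp 4 * (1 + j) := by
    calc _ ≤ ∏ p ∈ Nat.primesLE (2 ^ j), (1 - (p : ℝ)⁻¹)⁻¹ := by
          refine Finset.prod_le_prod_of_subset_of_one_le (fun p hp => ?_) (fun p hp => ?_)
            (fun p hp _ => hfac1 p (Nat.prime_of_mem_primesLE hp))
          · rw [Finset.mem_filter] at hp
            exact Nat.mem_primesLE.2 ⟨hp.2, Nat.prime_of_mem_primeFactors hp.1⟩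
          · exact zero_le_one.trans
              (hfac1 p (Nat.prime_of_mem_primeFactors (Finset.mem_filter.1 hp).1))
      _ ≤ Real.exp 4 * (1 + Real.log ((2 ^ j : ℕ) : ℝ)) :=
          prod_primesLE_le (by simpa using Nat.pow_le_pow_right (n := 2) (by norm_num) hj)
      _ ≤ _ := by
          have : Real.log 2 ≤ 1 := by have := Real.log_two_lt_d9; linarith
          push_cast
          rw [Real.log_pow]
          gcongr
          nlinarith [(Nat.cast_nonneg j : (0 : ℝ) ≤ j)]
  have hlarge : ∏ p ∈ n.primeFactors with ¬ p ≤ 2 ^ j, (1 - (p : ℝ)⁻¹)⁻¹ ≤ Real.exp 1 := by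
    have hterm : ∀ p ∈ n.primeFactors.filter (fun p => ¬ p ≤ 2 ^ j),
        (1 - (p : ℝ)⁻¹)⁻¹ ≤ Real.exp ((2 ^ j : ℝ)⁻¹) := by
      intro p hp
      have hp1 : 2 ^ j + 1 ≤ p := by
        have := (Finset.mem_filter.1 hp).2; omega
      have hp2 : (2 ^ j : ℝ) + 1 ≤ p := by exact_mod_cast hp1
      have hJ : (0 : ℝ) < 2 ^ j := by positivity
      have hp0 : (0 : ℝ) < p := by linarith
      have := Real.add_one_le_exp ((2 ^ j : ℝ)⁻¹)
      refine le_trans ?_ this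
      have h1 : (1 - (p : ℝ)⁻¹)⁻¹ = p / (p - 1) := by
        have : (p : ℝ) - 1 ≠ 0 := by linarith
        field_simp
      have h2 : (2 ^ j : ℝ)⁻¹ + 1 = (2 ^ j + 1) / 2 ^ j := by field_simp; ring
      rw [h1, h2, div_le_div_iff₀ (by linarith) hJ]
      nlinarith
    have hcard : (n.primeFactors.filter (fun p => ¬ p ≤ 2 ^ j)).card ≤ 2 ^ j := by
      have h1 : 2 ^ (n.primeFactors.card) ≤ n := by
        calc 2 ^ n.primeFactors.card ≤ ∏ p ∈ n.primeFactors, p :=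
              Finset.pow_card_le_prod _ _ _ fun p hp => (Nat.prime_of_mem_primeFactors hp).two_le
          _ ≤ n := Nat.le_of_dvd (Nat.pos_of_ne_zero hn) (Nat.prod_primeFactors_dvd n)
      have h2 := (Nat.pow_le_pow_iff_right (by norm_num : 1 < 2)).1 (h1.trans hnj)
      exact (Finset.card_filter_le _ _).trans h2
    calc _ ≤ ∏ p ∈ n.primeFactors.filter (fun p => ¬ p ≤ 2 ^ j), Real.exp ((2 ^ j : ℝ)⁻¹) := by
          refine Finset.prod_le_prod (fun p hp => ?_) hterm
          exact zero_le_one.trans (hfac1 p (Nat.prime_of_mem_primeFactors (Finset.mem_filter.1 hp).1))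
      _ = Real.exp ((n.primeFactors.filter (fun p => ¬ p ≤ 2 ^ j)).card * (2 ^ j : ℝ)⁻¹) := by
          rw [Finset.prod_const, Real.exp_nat_mul]
      _ ≤ Real.exp 1 := by
          rw [Real.exp_le_exp, ← div_eq_mul_inv, div_le_one (by positivity)]
          exact_mod_cast hcard
  calc _ ≤ Real.exp 4 * (1 + j) * Real.exp 1 := by
        refine mul_le_mul hsmall hlarge (Finset.prod_nonneg fun p hp => ?_) (by positivity)
        exact zero_le_one.trans (hfac1 p (Nat.prime_of_mem_primeFactors (Finset.mem_filter.1 hp).1))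
    _ = _ := by rw [mul_right_comm, ← Real.exp_add]; norm_num

/-! ### Averages of `k / φ(k)` and counting coprime residues in an interval -/

theorem prod_one_add_inv_le_sum_divisors {k : ℕ} (hk : k ≠ 0) :
    ∏ p ∈ k.primeFactors, (1 + (p : ℝ)⁻¹) ≤ ∑ e ∈ k.divisors, (e : ℝ)⁻¹ := by
  rw [Finset.prod_one_add]
  have hinj : Set.InjOn (fun t : Finset ℕ => ∏ p ∈ t, p) k.primeFactors.powerset := by
    intro t ht u hu htu
    have h : ∀ t ∈ k.primeFactors.powerset, (∏ p ∈ t, p).primeFactors = t := fun t ht =>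
      Nat.primeFactors_prod fun p hp => Nat.prime_of_mem_primeFactors (Finset.mem_powerset.1 ht hp)
    rw [← h t ht, ← h u hu]
    exact congrArg _ htu
  calc ∑ t ∈ k.primeFactors.powerset, ∏ p ∈ t, (p : ℝ)⁻¹
      = ∑ e ∈ k.primeFactors.powerset.image (fun t => ∏ p ∈ t, p), (e : ℝ)⁻¹ := by
        rw [Finset.sum_image hinj]
        refine Finset.sum_congr rfl fun t _ => ?_
        push_cast
        rw [Finset.prod_inv_distrib]
    _ ≤ _ := by
        refine Finset.sum_le_sum_of_subset_of_nonneg (fun e he => ?_) (fun _ _ _ => by positivity)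
        obtain ⟨t, ht, rfl⟩ := Finset.mem_image.1 he
        exact Nat.mem_divisors.2 ⟨(Finset.prod_dvd_prod_of_subset _ _ _
          (Finset.mem_powerset.1 ht)).trans
          (Nat.prod_primeFactors_dvd k), hk⟩

/-- The partial products of `∏ (1 - i⁻²)` over `2 ≤ i ≤ n` telescope to `(n + 1) / (2 n)`. -/
theorem prod_one_sub_inv_sq_ge (s : Finset ℕ) (hs : ∀ i ∈ s, 2 ≤ i) :
    1 / 2 ≤ ∏ i ∈ s, (1 - ((i : ℝ)⁻¹) ^ 2) := by
  have htel : ∀ n : ℕ, ∏ i ∈ Finset.Ico 2 (n + 2), (1 - ((i : ℝ)⁻¹) ^ 2) =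
      ((n : ℝ) + 2) / (2 * (n + 1)) := by
    intro n
    induction n with
    | zero => norm_num
    | succ n ih =>
      rw [Finset.prod_Ico_succ_top (by omega), ih]
      push_cast
      have : (n : ℝ) + 2 ≠ 0 := by positivity
      field_simp
      ring
  have hsub : s ⊆ Finset.Ico 2 (s.sup id + 2) := fun i hi => by
    have : i ≤ s.sup id := Finset.le_sup (f := id) hi
    exact Finset.mem_Ico.2 ⟨hs i hi, by omega⟩
  have hfac : ∀ i : ℕ, 2 ≤ i → 0 ≤ 1 - ((i : ℝ)⁻¹) ^ 2 := by
    intro i hi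
    have : (1 : ℝ) ≤ i := by exact_mod_cast (by omega : 1 ≤ i)
    have h1 := inv_le_one_of_one_le₀ this
    have h0 : 0 ≤ (i : ℝ)⁻¹ := by positivity
    nlinarith
  calc (1 : ℝ) / 2 ≤ ((s.sup id : ℕ) + 2) / (2 * ((s.sup id : ℕ) + 1)) := by
        rw [div_le_div_iff₀ (by norm_num) (by positivity)]
        linarith
    _ = ∏ i ∈ Finset.Ico 2 (s.sup id + 2), (1 - ((i : ℝ)⁻¹) ^ 2) := (htel _).symm
    _ ≤ _ := by
        refine Finset.prod_le_prod_of_subset_of_le_one hsub ?_ ?_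
        · intro i hi; exact hfac i (Finset.mem_Ico.1 hi).1
        · intro i hi _
          have := sq_nonneg ((i : ℝ)⁻¹); linarith

theorem div_totient_le_sum_divisors {k : ℕ} (hk : k ≠ 0) :
    (k : ℝ) / k.totient ≤ 2 * ∑ e ∈ k.divisors, (e : ℝ)⁻¹ := by
  have h1 := prod_one_sub_inv_sq_ge k.primeFactors
    fun p hp => (Nat.prime_of_mem_primeFactors hp).two_le
  have h2 : ∏ p ∈ k.primeFactors, (1 - ((p : ℝ)⁻¹) ^ 2) =
      (k.totient : ℝ) / k * ∏ p ∈ k.primeFactors, (1 + (p : ℝ)⁻¹) := by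
    rw [totient_div_eq_prod hk, ← Finset.prod_mul_distrib]
    exact Finset.prod_congr rfl fun p _ => by ring
  have hφ : (0 : ℝ) < k.totient := by exact_mod_cast Nat.totient_pos.2 (Nat.pos_of_ne_zero hk)
  have hk0 : (0 : ℝ) < k := by exact_mod_cast Nat.pos_of_ne_zero hk
  rw [h2] at h1
  refine le_trans ?_ (mul_le_mul_of_nonneg_left (prod_one_add_inv_le_sum_divisors hk) two_pos.le)
  rw [div_le_iff₀ hφ]
  rw [div_mul_eq_mul_div, div_le_div_iff₀ two_pos hk0] at h1
  linarith

/-- The function `k / φ(k)` is bounded on average. -/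
theorem sum_div_totient_le (K : ℕ) :
    ∑ k ∈ Finset.Icc 1 K, (k : ℝ) / k.totient ≤ 4 * K := by
  have hsq : ∑ e ∈ Finset.Icc 1 K, ((e : ℝ) ^ 2)⁻¹ ≤ 2 := by
    have h := sum_Ioc_inv_sq_le_sub (α := ℝ) (k := 1) (n := K + 1) one_ne_zero (by omega)
    rcases Nat.eq_zero_or_pos K with rfl | hK
    · simp
    rw [Finset.Icc_eq_cons_Ioc hK, Finset.sum_cons]
    have h3 : ∑ i ∈ Finset.Ioc 1 K, ((i : ℝ) ^ 2)⁻¹ ≤ ∑ i ∈ Finset.Ioc 1 (K + 1), ((i : ℝ) ^ 2)⁻¹ :=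
      Finset.sum_le_sum_of_subset_of_nonneg (Finset.Ioc_subset_Ioc_right (by omega))
        fun _ _ _ => by positivity
    have h4 : (0 : ℝ) ≤ ((K + 1 : ℕ) : ℝ)⁻¹ := by positivity
    norm_num at h h3 ⊢
    push_cast at h h3 h4
    linarith
  calc ∑ k ∈ Finset.Icc 1 K, (k : ℝ) / k.totient
      ≤ ∑ k ∈ Finset.Icc 1 K, 2 * ∑ e ∈ k.divisors, (e : ℝ)⁻¹ :=
        Finset.sum_le_sum fun k hk => div_totient_le_sum_divisors
          (by have := (Finset.mem_Icc.1 hk).1; omega)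
    _ = 2 * ∑ k ∈ Finset.Icc 1 K, ∑ e ∈ Finset.Icc 1 K, if e ∣ k then (e : ℝ)⁻¹ else 0 := by
        rw [Finset.mul_sum]
        refine Finset.sum_congr rfl fun k hk => ?_
        rw [← Finset.sum_filter]
        congr 1
        refine Finset.sum_congr ?_ fun _ _ => rfl
        ext e
        simp only [Nat.mem_divisors, Finset.mem_filter, Finset.mem_Icc] at hk ⊢
        constructor
        · rintro ⟨h1, h2⟩
          exact ⟨⟨Nat.pos_of_dvd_of_pos h1 (by omega), (Nat.le_of_dvd (by omega) h1).trans hk.2⟩, h1⟩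
        · rintro ⟨h1, h2⟩
          exact ⟨h2, by omega⟩
    _ = 2 * ∑ e ∈ Finset.Icc 1 K, ((K / e : ℕ) : ℝ) * (e : ℝ)⁻¹ := by
        rw [Finset.sum_comm]
        congr 1
        refine Finset.sum_congr rfl fun e he => ?_
        rw [← Finset.sum_filter, Finset.sum_const, nsmul_eq_mul]
        congr 2
        exact Nat.Ioc_filter_dvd_card_eq_div K e
    _ ≤ 2 * ∑ e ∈ Finset.Icc 1 K, (K : ℝ) * ((e : ℝ) ^ 2)⁻¹ := by
        refine mul_le_mul_of_nonneg_left (Finset.sum_le_sum fun e _ => ?_) two_pos.le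
        calc ((K / e : ℕ) : ℝ) * (e : ℝ)⁻¹ ≤ (K / e : ℝ) * (e : ℝ)⁻¹ := by
              gcongr; exact Nat.cast_div_le
          _ = _ := by rw [div_eq_mul_inv, mul_assoc, ← mul_inv, ← sq]
    _ ≤ 4 * K := by
        rw [← Finset.mul_sum]
        have : (0 : ℝ) ≤ K := by positivity
        nlinarith

/-- Legendre's sieve with its trivial error term. -/
theorem card_coprime_Ioc_ge {n u v : ℕ} (hn : n ≠ 0) (huv : u ≤ v) :
    ((v : ℝ) - u) * ((n.totient : ℝ) / n) - n.divisors.card ≤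
      ((Finset.Ioc u v).filter (fun a => a.Coprime n)).card := by
  have hcount : ∀ w : ℕ, (((Finset.Ioc 0 w).filter (fun a => a.Coprime n)).card : ℤ) =
      ∑ e ∈ n.divisors, ArithmeticFunction.moebius e * ((w / e : ℕ) : ℤ) := by
    intro w
    have hind : ∀ a ∈ Finset.Ioc 0 w, (if a.Coprime n then (1 : ℤ) else 0) =
        ∑ e ∈ n.divisors, if e ∣ a then ArithmeticFunction.moebius e else 0 := by
      intro a ha
      have ha0 : 0 < a := (Finset.mem_Ioc.1 ha).1
      have hdiv : n.divisors.filter (fun e => e ∣ a) = (Nat.gcd a n).divisors := by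
        ext e
        simp [Nat.dvd_gcd_iff, hn]
        tauto
      rw [← Finset.sum_filter, hdiv]
      have := congrArg (fun f : ArithmeticFunction ℤ => f (Nat.gcd a n))
        ArithmeticFunction.moebius_mul_coe_zeta
      simp only [ArithmeticFunction.coe_mul_zeta_apply, ArithmeticFunction.one_apply] at this
      rw [this]
    rw [Finset.card_filter]
    push_cast
    rw [Finset.sum_congr rfl hind, Finset.sum_comm]
    refine Finset.sum_congr rfl fun e _ => ?_
    rw [← Finset.sum_filter, Finset.sum_const, Nat.Ioc_filter_dvd_card_eq_div]
    simp [mul_comm]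
  have hsplit : (((Finset.Ioc u v).filter (fun a => a.Coprime n)).card : ℤ) =
      ((Finset.Ioc 0 v).filter (fun a => a.Coprime n)).card -
      ((Finset.Ioc 0 u).filter (fun a => a.Coprime n)).card := by
    rw [eq_sub_iff_add_eq, add_comm]
    norm_cast
    rw [← Finset.card_union_of_disjoint, ← Finset.filter_union,
      Finset.Ioc_union_Ioc_eq_Ioc (Nat.zero_le u) huv]
    refine Finset.disjoint_filter_filter ?_
    exact Finset.Ioc_disjoint_Ioc_of_le le_rfl
  have hφ : (n.totient : ℝ) / n =
      ∑ e ∈ n.divisors, (ArithmeticFunction.moebius e : ℝ) * (e : ℝ)⁻¹ := by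
    have h1 : ((Finset.Ioc 0 n).filter (fun a => a.Coprime n)).card = n.totient := by
      rw [← Nat.filter_coprime_Ico_eq_totient n 1]
      congr 1
      ext a
      simp only [Finset.mem_filter, Finset.mem_Ioc, Finset.mem_Ico, Nat.coprime_comm]
      omega
    have h2 := congrArg (fun z : ℤ => (z : ℝ)) (hcount n)
    simp only [h1] at h2
    simp only [Int.cast_sum, Int.cast_mul, Int.cast_natCast] at h2
    rw [h2, Finset.sum_div]
    refine Finset.sum_congr rfl fun e he => ?_
    have he' := Nat.dvd_of_mem_divisors he
    have he0 : (e : ℝ) ≠ 0 := by exact_mod_cast (Nat.pos_of_mem_divisors he).ne'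
    have hn0 : (n : ℝ) ≠ 0 := by exact_mod_cast hn
    rw [Nat.cast_div he' he0]
    field_simp
  rw [hcount, hcount, ← Finset.sum_sub_distrib] at hsplit
  have hR : (((Finset.Ioc u v).filter (fun a => a.Coprime n)).card : ℝ) =
      ∑ e ∈ n.divisors, (ArithmeticFunction.moebius e : ℝ) *
        (((v / e : ℕ) : ℝ) - ((u / e : ℕ) : ℝ)) := by
    have := congrArg (fun z : ℤ => (z : ℝ)) hsplit
    simp only [Int.cast_sum, Int.cast_sub, Int.cast_mul, Int.cast_natCast] at this
    rw [this]
    exact Finset.sum_congr rfl fun e _ => by ring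
  rw [hR, hφ, Finset.mul_sum, sub_le_iff_le_add, Finset.card_eq_sum_ones, Nat.cast_sum,
    ← Finset.sum_add_distrib]
  refine Finset.sum_le_sum fun e he => ?_
  have he0 : (0 : ℝ) < e := by exact_mod_cast Nat.pos_of_mem_divisors he
  have hfl : ∀ w : ℕ, ((w / e : ℕ) : ℝ) ≤ w * (e : ℝ)⁻¹ ∧ w * (e : ℝ)⁻¹ < ((w / e : ℕ) : ℝ) + 1 := by
    intro w
    rw [← div_eq_mul_inv]
    refine ⟨Nat.cast_div_le, ?_⟩
    rw [div_lt_iff₀ he0]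
    have := Nat.lt_mul_div_succ w (Nat.pos_of_mem_divisors he)
    rw [mul_comm] at this
    exact_mod_cast this
  have hμ : |(ArithmeticFunction.moebius e : ℝ)| ≤ 1 := by
    exact_mod_cast ArithmeticFunction.abs_moebius_le_one
  have hdiff : |((v : ℝ) - u) * (e : ℝ)⁻¹ - (((v / e : ℕ) : ℝ) - ((u / e : ℕ) : ℝ))| ≤ 1 := by
    rw [abs_le]
    have := hfl u
    have := hfl v
    constructor <;> linarith
  have hmul := abs_mul (ArithmeticFunction.moebius e : ℝ)
    (((v : ℝ) - u) * (e : ℝ)⁻¹ - (((v / e : ℕ) : ℝ) - ((u / e : ℕ) : ℝ)))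
  have hle := mul_le_mul hμ hdiff (abs_nonneg _) zero_le_one
  rw [← hmul] at hle
  have := (abs_le.1 hle).2
  push_cast
  linarith

theorem card_divisors_le_two_mul_sqrt (n : ℕ) : (n.divisors.card : ℝ) ≤ 2 * Real.sqrt n := by
  have hsub : n.divisors ⊆ Finset.Icc 1 n.sqrt ∪ (Finset.Icc 1 n.sqrt).image (fun e => n / e) := by
    intro e he
    have he' := Nat.dvd_of_mem_divisors he
    have he0 := Nat.pos_of_mem_divisors he
    have hn := (Nat.mem_divisors.1 he).2
    obtain ⟨f, rfl⟩ := he'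
    have hf0 : 0 < f := Nat.pos_of_ne_zero fun h => hn (by simp [h])
    rw [Finset.mem_union]
    rcases le_total e f with h | h
    · exact Or.inl (Finset.mem_Icc.2 ⟨he0, Nat.le_sqrt.2 (Nat.mul_le_mul_left e h)⟩)
    · refine Or.inr (Finset.mem_image.2 ⟨f, Finset.mem_Icc.2 ⟨hf0, Nat.le_sqrt.2 ?_⟩, ?_⟩)
      · exact Nat.mul_le_mul_right f h
      · exact Nat.mul_div_cancel e hf0
  have h1 : n.divisors.card ≤ 2 * n.sqrt := by
    refine (Finset.card_le_card hsub).trans ((Finset.card_union_le _ _).trans ?_)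
    have := Finset.card_image_le (s := Finset.Icc 1 n.sqrt) (f := fun e => n / e)
    simp only [Nat.card_Icc] at this ⊢
    omega
  have h2 : (n.sqrt : ℝ) ≤ Real.sqrt n := Real.nat_sqrt_le_real_sqrt
  have h3 : (n.divisors.card : ℝ) ≤ 2 * n.sqrt := by exact_mod_cast h1
  linarith

/-! ### Counting nearby pairs of reduced fractions -/

/-- The Chinese remainder theorem as an upper bound: prescribing the residues modulo the prime
factors of `d` that are allowed cuts an interval of length `d` down by the expected proportion. -/
theorem card_filter_residues_le {d : ℕ} (hd : d ≠ 0) (G : ∀ p : ℕ, Finset (ZMod p)) (x : ℤ) :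
    (((Finset.Ico x (x + d)).filter
      (fun t => ∀ p ∈ d.primeFactors, (t : ZMod p) ∈ G p)).card : ℝ) ≤
      d * ∏ p ∈ d.primeFactors, ((G p).card : ℝ) / p := by
  set R : ℕ := ∏ p ∈ d.primeFactors, p with hR
  have hRd : R ∣ d := Nat.prod_primeFactors_dvd d
  have hR0 : 0 < R := Nat.pos_of_dvd_of_pos hRd (Nat.pos_of_ne_zero hd)
  have hblock : ∀ y : ℤ, ((Finset.Ico y (y + R)).filter
      (fun t => ∀ p ∈ d.primeFactors, (t : ZMod p) ∈ G p)).card ≤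
      ∏ p ∈ d.primeFactors, (G p).card := by
    intro y
    rw [← Finset.card_pi]
    refine Finset.card_le_card_of_injOn (fun t p _ => (t : ZMod p)) ?_ ?_
    · intro t ht
      rw [Finset.mem_coe, Finset.mem_filter] at ht
      exact Finset.mem_coe.2 (Finset.mem_pi.2 ht.2)
    · intro t ht u hu htu
      rw [Finset.mem_coe, Finset.mem_filter, Finset.mem_Ico] at ht hu
      have hdvd : (R : ℤ) ∣ t - u := by
        rw [hR]
        push_cast
        refine Finset.prod_dvd_of_isRelPrime ?_ ?_
        · intro p hp q hq hpq
          exact IsCoprime.isRelPrime (Nat.isCoprime_iff_coprime.2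
            ((Nat.coprime_primes (Nat.prime_of_mem_primeFactors hp)
              (Nat.prime_of_mem_primeFactors hq)).2 hpq))
        · intro p hp
          have := congrFun (congrFun htu p) hp
          rw [← ZMod.intCast_zmod_eq_zero_iff_dvd]
          push_cast
          exact sub_eq_zero.2 this
      have habs : |t - u| < R := by rw [abs_lt]; constructor <;> linarith [ht.1, hu.1]
      have := Int.eq_zero_of_abs_lt_dvd hdvd habs
      linarith
  obtain ⟨q, hq⟩ := hRd
  have hmul : ∀ q : ℕ, ((Finset.Ico x (x + (R * q : ℕ))).filter
      (fun t => ∀ p ∈ d.primeFactors, (t : ZMod p) ∈ G p)).card ≤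
      q * ∏ p ∈ d.primeFactors, (G p).card := by
    intro q
    induction q with
    | zero => simp
    | succ q ih =>
      have hsplit : Finset.Ico x (x + (R * (q + 1) : ℕ)) =
          Finset.Ico x (x + (R * q : ℕ)) ∪
            Finset.Ico (x + (R * q : ℕ)) (x + (R * q : ℕ) + R) := by
        rw [Finset.Ico_union_Ico_eq_Ico (by simp; positivity) (by simp)]
        congr 1; push_cast; ring
      rw [hsplit, Finset.filter_union]
      refine (Finset.card_union_le _ _).trans ?_
      have := hblock (x + (R * q : ℕ))
      rw [add_mul, one_mul]
      omega
  have hfin := hmul q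
  rw [← hq] at hfin
  have hR0' : (R : ℝ) ≠ 0 := by exact_mod_cast hR0.ne'
  calc _ ≤ ((q * ∏ p ∈ d.primeFactors, (G p).card : ℕ) : ℝ) := by exact_mod_cast hfin
    _ = _ := by
      have hRr : (R : ℝ) = ∏ p ∈ d.primeFactors, (p : ℝ) := by rw [hR]; push_cast; rfl
      rw [Finset.prod_div_distrib, ← hRr]
      have hdq : (d : ℝ) = R * q := by rw [← Nat.cast_mul, ← hq]
      rw [hdq]
      push_cast
      rw [mul_comm (R : ℝ) q, mul_assoc, mul_div_cancel₀ _ hR0']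

/-- The pairs `(a, b)` of reduced residues modulo `m = d m'` and `n = d n'` with
`a n' - b m' = k`. -/
noncomputable def reducedPairs (d m' n' : ℕ) (k : ℤ) : Finset (ℤ × ℤ) :=
  (Finset.Ico (0 : ℤ) (d * m' : ℕ) ×ˢ Finset.Ico (0 : ℤ) (d * n' : ℕ)).filter fun z =>
    IsCoprime z.1 ((d * m' : ℕ) : ℤ) ∧ IsCoprime z.2 ((d * n' : ℕ) : ℤ) ∧ z.1 * n' - z.2 * m' = k

theorem prod_primeFactors_eq_prod_ite {d M : ℕ} (hM : M ≠ 0) (hd : d ∣ M) (f : ℕ → ℝ) :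
    ∏ p ∈ d.primeFactors, f p = ∏ p ∈ M.primeFactors, if p ∣ d then f p else 1 := by
  rw [← Finset.prod_filter]
  refine Finset.prod_congr ?_ fun _ _ => rfl
  ext p
  simp only [Nat.mem_primeFactors, Finset.mem_filter]
  constructor
  · rintro ⟨h1, h2, h3⟩; exact ⟨⟨h1, h2.trans hd, hM⟩, h2⟩
  · rintro ⟨⟨h1, h2, h3⟩, h4⟩; exact ⟨h1, h4, ne_zero_of_dvd_ne_zero hM hd⟩

/-- Solutions lie on a line `(a₀ + m' t, b₀ + n' t)`, with `t` in an interval of length `d`. A prime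
`p ∣ d` forbids at least one class for `t`, and two when `p ∤ m' n' k`. -/
theorem card_reducedPairs_le_prod {d m' n' : ℕ} (hd : d ≠ 0) (hm : m' ≠ 0)
    (hcop : m'.Coprime n') (k : ℤ) :
    ((reducedPairs d m' n' k).card : ℝ) ≤ d * ∏ p ∈ d.primeFactors,
      (if p ∣ m' * n' ∨ (p : ℤ) ∣ k then 1 - (p : ℝ)⁻¹ else 1 - 2 * (p : ℝ)⁻¹) := by
  rcases (reducedPairs d m' n' k).eq_empty_or_nonempty with h | ⟨⟨a₀, b₀⟩, h₀⟩
  · rw [h, Finset.card_empty, Nat.cast_zero]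
    refine mul_nonneg (by positivity) (Finset.prod_nonneg fun p hp => ?_)
    have hp2 : (2 : ℝ) ≤ p := by exact_mod_cast (Nat.prime_of_mem_primeFactors hp).two_le
    have : (p : ℝ)⁻¹ ≤ 1 / 2 := by
      rw [inv_eq_one_div]; exact one_div_le_one_div_of_le two_pos hp2
    split_ifs <;> linarith
  have hm0 : (0 : ℤ) < m' := by exact_mod_cast Nat.pos_of_ne_zero hm
  simp only [reducedPairs, Finset.mem_filter, Finset.mem_product, Finset.mem_Ico] at h₀
  obtain ⟨⟨⟨ha0, ha1⟩, hb0, hb1⟩, ha, hb, hk⟩ := h₀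
  let G : ∀ p : ℕ, Finset (ZMod p) := fun p =>
    if hp : p.Prime then
      haveI := Fact.mk hp
      Finset.univ.filter fun r : ZMod p =>
        (a₀ : ZMod p) + m' * r ≠ 0 ∧ (b₀ : ZMod p) + n' * r ≠ 0
    else ∅
  have hpar : ∀ z ∈ reducedPairs d m' n' k,
      z.1 = a₀ + m' * ((z.1 - a₀) / m') ∧ z.2 = b₀ + n' * ((z.1 - a₀) / m') := by
    rintro ⟨a, b⟩ hz
    simp only [reducedPairs, Finset.mem_filter, Finset.mem_product, Finset.mem_Ico] at hz
    obtain ⟨-, -, -, hk'⟩ := hz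
    have hrel : (a - a₀) * n' = (b - b₀) * m' := by linarith
    have hdvd : (m' : ℤ) ∣ a - a₀ := by
      have : (m' : ℤ) ∣ (a - a₀) * n' := ⟨b - b₀, by rw [hrel]; ring⟩
      exact IsCoprime.dvd_of_dvd_mul_right (Nat.isCoprime_iff_coprime.2 hcop) this
    obtain ⟨t, ht⟩ := hdvd
    have htdiv : (a - a₀) / m' = t := by rw [ht]; exact Int.mul_ediv_cancel_left _ hm0.ne'
    rw [htdiv]
    refine ⟨by linarith, ?_⟩
    have : (b - b₀) * m' = (n' * t) * m' := by rw [← hrel, ht]; ring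
    have := mul_right_cancel₀ hm0.ne' this
    linarith
  have hcard : (reducedPairs d m' n' k).card ≤
      ((Finset.Ico (-(a₀ / m')) (-(a₀ / m') + d)).filter
        (fun t : ℤ => ∀ p ∈ d.primeFactors, (t : ZMod p) ∈ G p)).card := by
    refine Finset.card_le_card_of_injOn (fun z => (z.1 - a₀) / m') ?_ ?_
    · intro z hz
      have hz' := hz
      obtain ⟨h1, h2⟩ := hpar z hz
      simp only [Finset.mem_coe, reducedPairs, Finset.mem_filter, Finset.mem_product,
        Finset.mem_Ico] at hz'
      obtain ⟨⟨⟨hz0, hz1⟩, -, -⟩, hca, hcb, -⟩ := hz'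
      set t := (z.1 - a₀) / m' with ht
      rw [h1] at hz0 hz1 hca
      rw [h2] at hcb
      have hq1 := Int.ediv_mul_le a₀ hm0.ne'
      have hq2 := Int.lt_ediv_add_one_mul_self a₀ hm0
      rw [Finset.mem_coe, Finset.mem_filter, Finset.mem_Ico]
      push_cast at hz1
      refine ⟨⟨?_, ?_⟩, ?_⟩
      · by_contra hlt
        have : t + 1 ≤ -(a₀ / m') := Int.add_one_le_of_lt (not_le.1 hlt)
        nlinarith
      · by_contra hlt
        have : -(a₀ / m') + d ≤ t := not_lt.1 hlt
        nlinarith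
      · intro p hp
        have hpp := Nat.prime_of_mem_primeFactors hp
        have hpd := Nat.dvd_of_mem_primeFactors hp
        have := Fact.mk hpp
        have key : ∀ (c : ℤ) (l : ℕ), IsCoprime c ((d * l : ℕ) : ℤ) → (c : ZMod p) ≠ 0 := by
          intro c l hc h0
          have h1 : (p : ℤ) ∣ c := (ZMod.intCast_zmod_eq_zero_iff_dvd c p).1 h0
          have h2 : (p : ℤ) ∣ ((d * l : ℕ) : ℤ) := by exact_mod_cast hpd.mul_right l
          have h3 := hc.isUnit_of_dvd' h1 h2
          exact (Nat.prime_iff_prime_int.1 hpp).not_isUnit h3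
        simp only [G, dif_pos hpp, Finset.mem_filter, Finset.mem_univ, true_and]
        have e1 := key _ _ hca
        have e2 := key _ _ hcb
        push_cast at e1 e2
        exact ⟨e1, e2⟩
    · intro z hz w hw hzw
      obtain ⟨h1, h2⟩ := hpar z hz
      obtain ⟨h3, h4⟩ := hpar w hw
      simp only at hzw
      rw [hzw] at h1 h2
      exact Prod.ext (h1.trans h3.symm) (h2.trans h4.symm)
  refine (Nat.cast_le.2 hcard).trans ((card_filter_residues_le hd G _).trans ?_)
  refine mul_le_mul_of_nonneg_left (Finset.prod_le_prod (fun _ _ => by positivity) ?_)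
    (by positivity)
  intro p hp
  have hpp := Nat.prime_of_mem_primeFactors hp
  have := Fact.mk hpp
  have hp0 : (0 : ℝ) < p := by exact_mod_cast hpp.pos
  have hG : G p = Finset.univ.filter fun r : ZMod p =>
        (a₀ : ZMod p) + m' * r ≠ 0 ∧ (b₀ : ZMod p) + n' * r ≠ 0 := by
    simp only [G, dif_pos hpp]
  -- A set of residues avoiding every member of `B` has at most `p - #B` elements.
  have hcompl : ∀ B : Finset (ZMod p), (∀ r ∈ B, r ∉ G p) →
      ((G p).card : ℝ) / p ≤ 1 - B.card * (p : ℝ)⁻¹ := by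
    intro B hB
    have h1 : (G p).card + B.card ≤ p := by
      rw [← Finset.card_union_of_disjoint (Finset.disjoint_right.2 hB)]
      exact (Finset.card_le_univ _).trans_eq (ZMod.card p)
    have h2 : ((G p).card : ℝ) + B.card ≤ p := by exact_mod_cast h1
    rw [div_le_iff₀ hp0, sub_mul, mul_assoc, inv_mul_cancel₀ hp0.ne']
    linarith
  have hroot : ∀ (c : ZMod p) (l : ℕ), ¬ p ∣ l → c + l * (-c / l) = 0 := by
    intro c l hl
    have : (l : ZMod p) ≠ 0 := fun h => hl ((ZMod.natCast_eq_zero_iff l p).1 h)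
    field_simp
    ring
  split_ifs with hc
  · by_cases hpm : p ∣ m'
    · have hpn : ¬ p ∣ n' := fun hpn => hpp.one_lt.ne' (Nat.eq_one_of_dvd_coprimes hcop hpm hpn)
      simpa using hcompl {-(b₀ : ZMod p) / n'} (by
        intro r hr
        rw [Finset.mem_singleton.1 hr, hG]
        simp [hroot _ _ hpn])
    · simpa using hcompl {-(a₀ : ZMod p) / m'} (by
        intro r hr
        rw [Finset.mem_singleton.1 hr, hG]
        simp [hroot _ _ hpm])
  · push Not at hc
    have hpm : ¬ p ∣ m' := fun h => hc.1 (h.mul_right _)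
    have hpn : ¬ p ∣ n' := fun h => hc.1 (h.mul_left _)
    have hne : -(a₀ : ZMod p) / m' ≠ -(b₀ : ZMod p) / n' := by
      intro heq
      have e1 := hroot (a₀ : ZMod p) m' hpm
      have e2 := hroot (b₀ : ZMod p) n' hpn
      rw [← heq] at e2
      refine hc.2 ((ZMod.intCast_zmod_eq_zero_iff_dvd k p).1 ?_)
      rw [← hk]
      push_cast
      linear_combination (n' : ZMod p) * e1 - (m' : ZMod p) * e2
    have := hcompl {-(a₀ : ZMod p) / m', -(b₀ : ZMod p) / n'} (by
        intro r hr
        rw [hG]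
        rcases Finset.mem_insert.1 hr with h | h
        · rw [h]; simp [hroot _ _ hpm]
        · rw [Finset.mem_singleton.1 h]; simp [hroot _ _ hpn])
    rw [Finset.card_pair hne] at this
    exact_mod_cast this

/-- The main counting bound. Both sides are products of local factors, compared prime by prime; the
factor `l / φ(l)`, `l = m' n'`, pays for the primes dividing `m' n'`. -/
theorem card_reducedPairs_le {d m' n' : ℕ} (hd : d ≠ 0) (hm : m' ≠ 0) (hn : n' ≠ 0)
    (hcop : m'.Coprime n') {k : ℤ} (hk : k ≠ 0) :
    ((reducedPairs d m' n' k).card : ℝ) ≤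
      d * (((m' * n' : ℕ) : ℝ) / (m' * n').totient *
        (((d * m').totient : ℝ) / (d * m' : ℕ)) * (((d * n').totient : ℝ) / (d * n' : ℕ)) *
        ((k.natAbs : ℝ) / k.natAbs.totient)) := by
  refine (card_reducedPairs_le_prod hd hm hcop k).trans
    (mul_le_mul_of_nonneg_left ?_ (by positivity))
  have hk' : k.natAbs ≠ 0 := Int.natAbs_ne_zero.2 hk
  rw [div_totient_eq_prod (mul_ne_zero hm hn), totient_div_eq_prod (mul_ne_zero hd hm),
    totient_div_eq_prod (mul_ne_zero hd hn), div_totient_eq_prod hk']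
  set M := d * m' * (d * n') * k.natAbs with hM
  have hM0 : M ≠ 0 := by positivity
  rw [prod_primeFactors_eq_prod_ite hM0 (d := d) ⟨m' * (d * n') * k.natAbs, by rw [hM]; ring⟩,
    prod_primeFactors_eq_prod_ite hM0 (d := m' * n') ⟨d * d * k.natAbs, by rw [hM]; ring⟩,
    prod_primeFactors_eq_prod_ite hM0 (d := d * m') ⟨d * n' * k.natAbs, by rw [hM]; ring⟩,
    prod_primeFactors_eq_prod_ite hM0 (d := d * n') ⟨d * m' * k.natAbs, by rw [hM]; ring⟩,
    prod_primeFactors_eq_prod_ite hM0 (d := k.natAbs) ⟨d * m' * (d * n'), by rw [hM]; ring⟩,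
    ← Finset.prod_mul_distrib, ← Finset.prod_mul_distrib, ← Finset.prod_mul_distrib]
  have hbound : ∀ p ∈ M.primeFactors, 0 < (p : ℝ)⁻¹ ∧ (p : ℝ)⁻¹ ≤ 1 / 2 := by
    intro p hp
    have hp2 : (2 : ℝ) ≤ p := by exact_mod_cast (Nat.prime_of_mem_primeFactors hp).two_le
    refine ⟨by positivity, ?_⟩
    rw [inv_eq_one_div]
    exact one_div_le_one_div_of_le two_pos hp2
  refine Finset.prod_le_prod (fun p hp => ?_) (fun p hp => ?_)
  · have := hbound p hp
    split_ifs <;> linarith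
  · obtain ⟨h0, h1⟩ := hbound p hp
    have hpp := Nat.prime_of_mem_primeFactors hp
    set y : ℝ := (p : ℝ)⁻¹
    have hx : 0 < 1 - y := by linarith
    have hxinv : 1 ≤ (1 - y)⁻¹ := (one_le_inv₀ hx).2 (by linarith)
    have hxx : (1 - y)⁻¹ * (1 - y) = 1 := inv_mul_cancel₀ hx.ne'
    have hnot : ¬ (p ∣ m' ∧ p ∣ n') := fun h =>
      hpp.one_lt.ne' (Nat.eq_one_of_dvd_coprimes hcop h.1 h.2)
    have hkk : (p : ℤ) ∣ k ↔ p ∣ k.natAbs := Int.natCast_dvd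
    simp only [hpp.dvd_mul, hkk]
    by_cases c1 : p ∣ d <;> by_cases c2 : p ∣ m' <;> by_cases c3 : p ∣ n' <;>
      by_cases c4 : p ∣ k.natAbs <;>
      simp only [c1, c2, c3, c4, if_true, if_false, true_or, or_true, or_self, mul_one, one_mul,
        hxx, not_true_eq_false, and_self, le_refl] at hnot ⊢ <;>
      nlinarith

/-- The pairs of reduced fractions `a / m`, `b / n` in `[0, 1)` with `|a n - b m| < X`. -/
noncomputable def closePairs (m n : ℕ) (X : ℝ) : Finset (ℤ × ℤ) :=
  (Finset.Ico (0 : ℤ) m ×ˢ Finset.Ico (0 : ℤ) n).filter fun z =>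
    IsCoprime z.1 (m : ℤ) ∧ IsCoprime z.2 (n : ℤ) ∧ |(z.1 : ℝ) * n - z.2 * m| < X

theorem ne_of_isCoprime {m n : ℕ} (hmn : m ≠ n) {a b : ℤ} (ha : IsCoprime a (m : ℤ))
    (hb : IsCoprime b (n : ℤ)) : a * n ≠ b * m := by
  intro h
  have h1 : (m : ℤ) ∣ n := ha.symm.dvd_of_dvd_mul_left ⟨b, by rw [h]; ring⟩
  have h2 : (n : ℤ) ∣ m := hb.symm.dvd_of_dvd_mul_left ⟨a, by rw [← h]; ring⟩
  exact hmn (Nat.dvd_antisymm (by exact_mod_cast h1) (by exact_mod_cast h2))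

theorem card_closePairs_le {m n : ℕ} (hm : m ≠ 0) (hn : n ≠ 0) (hmn : m ≠ n) {X C : ℝ}
    (hX : 0 ≤ X)
    (hC : ∀ l : ℕ, l ≠ 0 → l ≤ m * n → (l : ℝ) / l.totient ≤ C) :
    ((closePairs m n X).card : ℝ) ≤
      8 * C * X * ((m.totient : ℝ) / m) * ((n.totient : ℝ) / n) := by
  obtain ⟨d, m', n', hd, hcop, hmd, hnd⟩ :=
    Nat.exists_coprime' (Nat.gcd_pos_of_pos_left n (Nat.pos_of_ne_zero hm))
  rw [mul_comm] at hmd hnd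
  have hd0 : d ≠ 0 := hd.ne'
  have hm' : m' ≠ 0 := fun h => hm (by rw [hmd, h, mul_zero])
  have hn' : n' ≠ 0 := fun h => hn (by rw [hnd, h, mul_zero])
  have hdR : (0 : ℝ) < d := by exact_mod_cast hd
  set F : ℝ := ((m.totient : ℝ) / m) * ((n.totient : ℝ) / n) with hF
  have hF0 : 0 ≤ F := by positivity
  have hl := hC (m' * n') (mul_ne_zero hm' hn') (by
    rw [hmd, hnd]
    exact Nat.mul_le_mul (Nat.le_mul_of_pos_left _ hd) (Nat.le_mul_of_pos_left _ hd))
  have hC0 : 0 ≤ C := le_trans (by positivity) hl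
  set K : ℕ := ⌊X / d⌋₊ with hK
  have hred : ∀ k : ℤ, k ≠ 0 → ((reducedPairs d m' n' k).card : ℝ) ≤
      d * (C * F * ((k.natAbs : ℝ) / k.natAbs.totient)) := by
    intro k hk
    refine (card_reducedPairs_le hd0 hm' hn' hcop hk).trans ?_
    rw [← hmd, ← hnd, mul_assoc (((m' * n' : ℕ) : ℝ) / _), ← hF]
    gcongr
  have hmaps : ∀ z ∈ closePairs m n X, (z.1 * n' - z.2 * m').natAbs ∈ Finset.Icc 1 K := by
    intro z hz
    simp only [closePairs, Finset.mem_filter] at hz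
    obtain ⟨-, ha, hb, hlt⟩ := hz
    have hne := ne_of_isCoprime hmn ha hb
    rw [Finset.mem_Icc]
    constructor
    · rw [Nat.one_le_iff_ne_zero, Int.natAbs_ne_zero]
      intro h0
      apply hne
      rw [hmd, hnd]
      push_cast
      linear_combination (d : ℤ) * h0
    · rw [hK]
      apply Nat.le_floor
      rw [le_div_iff₀ hdR]
      have h1 : (z.1 : ℝ) * n - z.2 * m = d * ((z.1 * n' - z.2 * m' : ℤ) : ℝ) := by
        rw [hmd, hnd]
        push_cast
        ring
      rw [h1, abs_mul, abs_of_pos hdR] at hlt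
      rw [Nat.cast_natAbs, mul_comm, Int.cast_abs]
      exact hlt.le
  have hfiber : ∀ k ∈ Finset.Icc 1 K,
      (((closePairs m n X).filter fun z : ℤ × ℤ => (z.1 * n' - z.2 * m').natAbs = k).card : ℝ) ≤
        2 * d * C * F * ((k : ℝ) / k.totient) := by
    intro k hk
    have hk0 : (k : ℤ) ≠ 0 := by have := (Finset.mem_Icc.1 hk).1; omega
    have hsub : ((closePairs m n X).filter fun z : ℤ × ℤ => (z.1 * n' - z.2 * m').natAbs = k) ⊆
        reducedPairs d m' n' k ∪ reducedPairs d m' n' (-k) := by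
      intro z hz
      simp only [closePairs, reducedPairs, Finset.mem_filter, Finset.mem_union, ← hmd, ← hnd]
        at hz ⊢
      rcases Int.natAbs_eq_iff.1 hz.2 with h | h
      · exact Or.inl ⟨hz.1.1, hz.1.2.1, hz.1.2.2.1, h⟩
      · exact Or.inr ⟨hz.1.1, hz.1.2.1, hz.1.2.2.1, h⟩
    have h1 := (Finset.card_le_card hsub).trans (Finset.card_union_le _ _)
    have h2 : (((closePairs m n X).filter fun z : ℤ × ℤ => (z.1 * n' - z.2 * m').natAbs = k).card : ℝ) ≤
        (reducedPairs d m' n' k).card + (reducedPairs d m' n' (-k)).card := by exact_mod_cast h1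
    have h3 := hred k hk0
    have h4 := hred (-k) (neg_ne_zero.2 hk0)
    rw [Int.natAbs_neg] at h4
    rw [Int.natAbs_natCast] at h3 h4
    linarith
  rw [Finset.card_eq_sum_card_fiberwise hmaps]
  push_cast
  calc _ ≤ ∑ k ∈ Finset.Icc 1 K, 2 * d * C * F * ((k : ℝ) / k.totient) :=
        Finset.sum_le_sum hfiber
    _ = 2 * d * C * F * ∑ k ∈ Finset.Icc 1 K, ((k : ℝ) / k.totient) := by rw [Finset.mul_sum]
    _ ≤ 2 * d * C * F * (4 * K) := by gcongr; exact sum_div_totient_le K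
    _ ≤ 2 * d * C * F * (4 * (X / d)) := by
        gcongr
        exact Nat.floor_le (by positivity)
    _ = 8 * C * X * F := by field_simp; ring
    _ = _ := by rw [hF]; ring

/-! ### Lifting to the real line and pairwise overlaps -/

/-- The real numbers `x` with `|n x - a| < r` for some integer `a` coprime to `n`. -/
def nearReduced (n : ℕ) (r : ℝ) : Set ℝ :=
  {x | ∃ a : ℤ, IsCoprime a (n : ℤ) ∧ |(n : ℝ) * x - a| < r}

/-- Lebesgue measure on the fundamental domain `(0, 1]` of `ℝ / ℤ`. -/
noncomputable abbrev unitMeasure : Measure ℝ := volume.restrict (Set.Ioc 0 1)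

instance : IsProbabilityMeasure unitMeasure :=
  ⟨by simp [unitMeasure]⟩

theorem isOpen_nearReduced (n : ℕ) (r : ℝ) : IsOpen (nearReduced n r) := by
  have : nearReduced n r = ⋃ a : ℤ, ⋃ _ : IsCoprime a (n : ℤ), {x : ℝ | |(n : ℝ) * x - a| < r} := by
    ext x; simp [nearReduced]
  rw [this]
  refine isOpen_iUnion fun a => isOpen_iUnion fun _ => isOpen_lt (by fun_prop) continuous_const

theorem nearReduced_mono (n : ℕ) {r s : ℝ} (h : r ≤ s) : nearReduced n r ⊆ nearReduced n s :=
  fun _ ⟨a, ha, hx⟩ => ⟨a, ha, hx.trans_le h⟩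

theorem abs_mul_sub_lt_iff {n : ℕ} (hn : n ≠ 0) {x a r : ℝ} :
    |(n : ℝ) * x - a| < r ↔ x ∈ Set.Ioo ((a - r) / n) ((a + r) / n) := by
  have hn0 : (0 : ℝ) < n := by exact_mod_cast Nat.pos_of_ne_zero hn
  rw [abs_lt, Set.mem_Ioo, div_lt_iff₀ hn0, lt_div_iff₀ hn0]
  constructor <;> rintro ⟨h1, h2⟩ <;> constructor <;> linarith

/-- In `(0, 1]` only the numerators `0 ≤ a < n` matter, `a = n` not being coprime to `n`. -/
theorem numerator_mem_Ico {n : ℕ} (hn : 2 ≤ n) {r : ℝ} (hr : r ≤ 1 / 2) {x : ℝ}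
    (hx : x ∈ Set.Ioc (0 : ℝ) 1) {a : ℤ} (ha : IsCoprime a (n : ℤ))
    (hax : |(n : ℝ) * x - a| < r) : a ∈ Finset.Ico (0 : ℤ) n := by
  have hn0 : (0 : ℝ) < n := by positivity
  rw [abs_lt] at hax
  have h1 : (-1 : ℝ) < a := by nlinarith [mul_pos hn0 hx.1]
  have h2 : (a : ℝ) < n + 1 := by nlinarith [hx.2]
  have h1' : (-1 : ℤ) < a := by exact_mod_cast h1
  have h2' : a < (n : ℤ) + 1 := by exact_mod_cast h2
  have h3 : a ≠ n := by
    rintro rfl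
    have := Int.isUnit_iff.1 (isCoprime_self.1 ha)
    omega
  rw [Finset.mem_Ico]
  omega

/-- The overlap estimate: `nearReduced m r` and `nearReduced n s` are quasi-independent up to the
factor `C`, which bounds `l / φ(l)` for `l ≤ m n`. -/
theorem measure_inter_le {m n : ℕ} (hm : 2 ≤ m) (hn : 2 ≤ n) (hmn : m ≠ n) {r s C : ℝ}
    (hr0 : 0 ≤ r) (hr : r ≤ 1 / 2) (hs0 : 0 ≤ s) (hs : s ≤ 1 / 2)
    (hC : ∀ l : ℕ, l ≠ 0 → l ≤ m * n → (l : ℝ) / l.totient ≤ C) :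
    unitMeasure.real (nearReduced m r ∩ nearReduced n s) ≤
      32 * C * (r * m.totient / m) * (s * n.totient / n) := by
  have hm0 : (0 : ℝ) < m := by positivity
  have hn0 : (0 : ℝ) < n := by positivity
  have hC0 : 0 ≤ C := le_trans (by norm_num) (hC 1 one_ne_zero (by nlinarith))
  set X : ℝ := n * r + m * s with hX
  have hX0 : 0 ≤ X := by positivity
  let I : ℤ × ℤ → Set ℝ := fun z => {x | |(m : ℝ) * x - z.1| < r} ∩ {x | |(n : ℝ) * x - z.2| < s}
  have hsub : nearReduced m r ∩ nearReduced n s ∩ Set.Ioc 0 1 ⊆ ⋃ z ∈ closePairs m n X, I z := by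
    rintro x ⟨⟨⟨a, ha, hax⟩, b, hb, hbx⟩, hx⟩
    simp only [Set.mem_iUnion]
    refine ⟨(a, b), ?_, hax, hbx⟩
    simp only [closePairs, Finset.mem_filter, Finset.mem_product]
    refine ⟨⟨numerator_mem_Ico hm hr hx ha hax, numerator_mem_Ico hn hs hx hb hbx⟩, ha, hb, ?_⟩
    have h1 : (a : ℝ) * n - b * m = m * (n * x - b) - n * (m * x - a) := by ring
    rw [h1, hX]
    calc |m * (n * x - b) - n * (m * x - a)| ≤ |m * (n * x - b)| + |n * (m * x - a)| := abs_sub _ _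
      _ = m * |n * x - b| + n * |m * x - a| := by
        rw [abs_mul, abs_mul, abs_of_pos hm0, abs_of_pos hn0]
      _ < n * r + m * s := by nlinarith
  have hI : ∀ z, volume.real (I z) ≤ min (2 * (r / m)) (2 * (s / n)) := by
    intro z
    have key : ∀ (k : ℕ) (t c : ℝ), k ≠ 0 → 0 ≤ t → I z ⊆ {x | |(k : ℝ) * x - c| < t} →
        volume.real (I z) ≤ 2 * (t / k) := by
      intro k t c hk ht h
      have hset : {x | |(k : ℝ) * x - c| < t} = Set.Ioo ((c - t) / k) ((c + t) / k) :=
        Set.ext fun x => abs_mul_sub_lt_iff hk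
      rw [hset] at h
      refine (measureReal_mono h (by simp)).trans_eq ?_
      rw [Real.volume_real_Ioo_of_le (by gcongr; linarith)]
      ring
    exact le_min (key m r z.1 (by omega) hr0 Set.inter_subset_left)
      (key n s z.2 (by omega) hs0 Set.inter_subset_right)
  have hminX : min (2 * (r / m)) (2 * (s / n)) * X ≤ 4 * (r * s) := by
    have e1 : min (2 * (r / m)) (2 * (s / n)) * (n * r) ≤ 2 * (r * s) := by
      calc _ ≤ 2 * (s / n) * (n * r) := by gcongr; exact min_le_right _ _
        _ = _ := by field_simp
    have e2 : min (2 * (r / m)) (2 * (s / n)) * (m * s) ≤ 2 * (r * s) := by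
      calc _ ≤ 2 * (r / m) * (m * s) := by gcongr; exact min_le_left _ _
        _ = _ := by field_simp
    rw [hX, mul_add]
    linarith
  have hmin0 : 0 ≤ min (2 * (r / m)) (2 * (s / n)) := by positivity
  have hfin : volume (⋃ z ∈ closePairs m n X, I z) ≠ ⊤ := by
    refine ((measure_biUnion_lt_top (Finset.finite_toSet _) fun z _ => ?_)).ne
    have : I z ⊆ Set.Ioo ((z.1 - r) / m) ((z.1 + r) / m) := fun x hx =>
      (abs_mul_sub_lt_iff (by omega)).1 hx.1
    exact (measure_mono this).trans_lt (by simp)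
  calc unitMeasure.real (nearReduced m r ∩ nearReduced n s)
      = volume.real (nearReduced m r ∩ nearReduced n s ∩ Set.Ioc 0 1) := by
        rw [measureReal_restrict_apply
          ((isOpen_nearReduced m r).inter (isOpen_nearReduced n s)).measurableSet]
    _ ≤ volume.real (⋃ z ∈ closePairs m n X, I z) := measureReal_mono hsub hfin
    _ ≤ ∑ z ∈ closePairs m n X, volume.real (I z) := measureReal_biUnion_finset_le _ _
    _ ≤ ∑ z ∈ closePairs m n X, min (2 * (r / m)) (2 * (s / n)) := Finset.sum_le_sum fun z _ => hI z
    _ = min (2 * (r / m)) (2 * (s / n)) * (closePairs m n X).card := by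
        rw [Finset.sum_const, nsmul_eq_mul, mul_comm]
    _ ≤ min (2 * (r / m)) (2 * (s / n)) *
          (8 * C * X * ((m.totient : ℝ) / m) * ((n.totient : ℝ) / n)) := by
        gcongr
        exact card_closePairs_le (by omega) (by omega) hmn hX0 hC
    _ = min (2 * (r / m)) (2 * (s / n)) * X *
          (8 * C * ((m.totient : ℝ) / m) * ((n.totient : ℝ) / n)) := by ring
    _ ≤ 4 * (r * s) * (8 * C * ((m.totient : ℝ) / m) * ((n.totient : ℝ) / n)) := by gcongr
    _ = _ := by ring

/-! ### Equidistribution of reduced fractions in the complement of earlier sets -/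

theorem measure_nearReduced_cell_ge {n Q : ℕ} (hQ : Q ≠ 0) {r : ℝ} (hr0 : 0 ≤ r)
    (hr : r ≤ 1 / 2) (hnQ : 2 * Q * (3 + 2 * Real.sqrt n) ≤ n.totient) (j : ℕ) :
    r * n.totient / n / Q ≤
      volume.real (nearReduced n r ∩ Set.Ioc ((j : ℝ) / Q) ((j + 1 : ℝ) / Q)) := by
  have hQ0 : (0 : ℝ) < Q := by exact_mod_cast Nat.pos_of_ne_zero hQ
  have hsqrt := Real.sqrt_nonneg (n : ℝ)
  have hφ : (0 : ℝ) < n.totient := lt_of_lt_of_le (by positivity) hnQ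
  have hn : n ≠ 0 := by rintro rfl; simp at hφ
  have hn0 : (0 : ℝ) < n := by exact_mod_cast Nat.pos_of_ne_zero hn
  have hφn : (n.totient : ℝ) ≤ n := by exact_mod_cast Nat.totient_le n
  set u : ℕ := ⌈(n : ℝ) * (j / Q)⌉₊ with hu
  set v : ℕ := ⌊(n : ℝ) * ((j + 1) / Q)⌋₊ - 1 with hv
  have hu1 : (n : ℝ) * (j / Q) ≤ u := Nat.le_ceil _
  have hu2 : (u : ℝ) < n * (j / Q) + 1 := Nat.ceil_lt_add_one (by positivity)
  have hv1 : (⌊(n : ℝ) * ((j + 1) / Q)⌋₊ : ℝ) ≤ n * ((j + 1) / Q) := Nat.floor_le (by positivity)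
  have hv2 : (n : ℝ) * ((j + 1) / Q) < ⌊(n : ℝ) * ((j + 1) / Q)⌋₊ + 1 := Nat.lt_floor_add_one _
  have hφQ : 6 + 4 * Real.sqrt n ≤ n.totient / Q := by
    rw [le_div_iff₀ hQ0]; linarith
  have hnQ' : (n.totient : ℝ) / Q ≤ n / Q := by gcongr
  have hstep : (n : ℝ) * ((j + 1) / Q) = n * (j / Q) + n / Q := by field_simp
  have hfl1 : 1 ≤ ⌊(n : ℝ) * ((j + 1) / Q)⌋₊ := by
    rw [Nat.one_le_floor_iff, hstep]
    have : 0 ≤ (n : ℝ) * (j / Q) := by positivity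
    linarith
  have hvcast : (v : ℝ) = ⌊(n : ℝ) * ((j + 1) / Q)⌋₊ - 1 := by
    rw [hv, Nat.cast_sub hfl1, Nat.cast_one]
  have hvu : (n : ℝ) / Q - 3 ≤ v - u := by linarith
  have huv : u ≤ v := by
    have : (u : ℝ) ≤ v := by linarith
    exact_mod_cast this
  set A := (Finset.Ioc u v).filter (fun a => a.Coprime n) with hA
  have hcount : (n.totient : ℝ) / Q / 2 ≤ A.card := by
    have h1 := card_coprime_Ioc_ge hn huv
    have h2 := card_divisors_le_two_mul_sqrt n
    have h3 : ((n : ℝ) / Q - 3) * (n.totient / n) ≤ (v - u) * (n.totient / n) := by gcongr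
    have h4 : ((n : ℝ) / Q - 3) * (n.totient / n) = n.totient / Q - 3 * (n.totient / n) := by
      field_simp
    have h5 : (n.totient : ℝ) / n ≤ 1 := (div_le_one hn0).2 hφn
    linarith
  let I : ℕ → Set ℝ := fun a => Set.Ioo (((a : ℝ) - r) / n) (((a : ℝ) + r) / n)
  have hdisj : (A : Set ℕ).PairwiseDisjoint I := by
    intro a _ b _ hab
    refine Set.disjoint_left.2 fun x hx hy => hab ?_
    have h1 := abs_lt.1 ((abs_mul_sub_lt_iff hn).2 hx)
    have h2 := abs_lt.1 ((abs_mul_sub_lt_iff hn).2 hy)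
    have h3 : (a : ℝ) < b + 1 := by linarith
    have h4 : (b : ℝ) < a + 1 := by linarith
    have h3' : a < b + 1 := by exact_mod_cast h3
    have h4' : b < a + 1 := by exact_mod_cast h4
    omega
  have hsub : ⋃ a ∈ A, I a ⊆ nearReduced n r ∩ Set.Ioc ((j : ℝ) / Q) ((j + 1 : ℝ) / Q) := by
    intro x hx
    simp only [Set.mem_iUnion] at hx
    obtain ⟨a, ha, hax⟩ := hx
    rw [hA, Finset.mem_filter, Finset.mem_Ioc] at ha
    have hax' := (abs_mul_sub_lt_iff hn).2 hax
    refine ⟨⟨a, Nat.isCoprime_iff_coprime.2 ha.2, by exact_mod_cast hax'⟩, ?_⟩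
    rw [abs_lt] at hax'
    have h1 : (u : ℝ) + 1 ≤ a := by exact_mod_cast ha.1.1
    have h2 : (a : ℝ) ≤ v := by exact_mod_cast ha.1.2
    constructor
    · exact lt_of_mul_lt_mul_left (by linarith) hn0.le
    · exact le_of_mul_le_mul_left (by linarith) hn0
  calc r * n.totient / n / Q = 2 * r / n * (n.totient / Q / 2) := by field_simp
    _ ≤ 2 * r / n * A.card := by gcongr
    _ = ∑ a ∈ A, volume.real (I a) := by
        rw [Finset.sum_congr rfl (g := fun _ => 2 * r / n), Finset.sum_const, nsmul_eq_mul, mul_comm]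
        intro a _
        rw [Real.volume_real_Ioo_of_le (by gcongr; linarith)]
        ring
    _ = volume.real (⋃ a ∈ A, I a) :=
        (measureReal_biUnion_finset hdisj (fun _ _ => measurableSet_Ioo)
          (fun _ _ => by simp [I])).symm
    _ ≤ _ := measureReal_mono hsub ((measure_mono Set.inter_subset_right).trans_lt (by simp)).ne

/-- Among the cells `(j / Q, (j + 1) / Q]` of `(0, 1]`, at most `2 M²` contain both a point inside
and a point outside `⋃_{m ≤ M} nearReduced m (ρ m)`: such a cell contains one of the at most `2 m`
end points `(a ± ρ m) / m` belonging to some `m ≤ M`. -/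
theorem card_mixed_cells_le {M Q : ℕ} (hQ : Q ≠ 0) (ρ : ℕ → ℝ) (s : Finset ℕ)
    (hs : s ⊆ Finset.Icc 1 M) (B : Finset ℕ)
    (hB : ∀ j ∈ B, j < Q ∧ ∃ x ∈ Set.Ioc ((j : ℝ) / Q) ((j + 1 : ℝ) / Q),
      ∃ y ∈ Set.Ioc ((j : ℝ) / Q) ((j + 1 : ℝ) / Q),
        x ∈ (⋃ m ∈ s, nearReduced m (ρ m)) ∧ y ∉ ⋃ m ∈ s, nearReduced m (ρ m)) :
    B.card ≤ 2 * M ^ 2 := by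
  have hQ0 : (0 : ℝ) < Q := by exact_mod_cast Nat.pos_of_ne_zero hQ
  -- The end points in `(0, 1]` whose denominator is `m` and whose numerator is `-c` modulo `1`.
  let e : ℝ → ℕ × ℕ → ℝ := fun c z => ((⌊c⌋ + 1 + z.2 : ℤ) - c) / z.1
  let g : ℝ → ℕ := fun x => (⌈(Q : ℝ) * x⌉ - 1).toNat
  have hsub : B ⊆ ((Finset.Icc 1 M ×ˢ Finset.range M).image fun z => g (e (-ρ z.1) z)) ∪
      ((Finset.Icc 1 M ×ˢ Finset.range M).image fun z => g (e (ρ z.1) z)) := by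
    intro j hj
    obtain ⟨hjQ, x, hx, y, hy, hxV, hyV⟩ := hB j hj
    simp only [Set.mem_iUnion, not_exists] at hxV hyV
    obtain ⟨m, hms, a, ha, hax⟩ := hxV
    have hya : ¬ |(m : ℝ) * y - a| < ρ m := fun h => hyV m hms ⟨a, ha, h⟩
    have hmM := Finset.mem_Icc.1 (hs hms)
    have hm0 : (0 : ℝ) < m := by exact_mod_cast hmM.1
    have hj1 : ((j : ℝ) + 1) / Q ≤ 1 := by
      rw [div_le_one hQ0]; exact_mod_cast hjQ
    have hj0 : (0 : ℝ) ≤ (j : ℝ) / Q := by positivity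
    -- An end point lying in the cell is one of those listed by `e`, and `g` recovers the cell.
    have key : ∀ c t : ℝ, t * m = a - c → t ∈ Set.Ioc ((j : ℝ) / Q) ((j + 1 : ℝ) / Q) →
        ∃ i ∈ Finset.range M, g (e c (m, i)) = j := by
      intro c t ht hcell
      have ht0 : 0 < t := hj0.trans_lt hcell.1
      have ht1 : t ≤ 1 := hcell.2.trans hj1
      have h1 : c < a := by nlinarith
      have h2 : (a : ℝ) ≤ m + c := by nlinarith
      have h3 : ⌊c⌋ < a := Int.floor_lt.2 h1
      have h4 : a ≤ m + ⌊c⌋ := by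
        have : a - m ≤ ⌊c⌋ := Int.le_floor.2 (by push_cast; linarith)
        omega
      refine ⟨(a - ⌊c⌋ - 1).toNat, Finset.mem_range.2 (by omega), ?_⟩
      have hi : ⌊c⌋ + 1 + ((a - ⌊c⌋ - 1).toNat : ℤ) = a := by omega
      have he : e c (m, (a - ⌊c⌋ - 1).toNat) = t := by
        simp only [e, hi]
        rw [div_eq_iff hm0.ne', ht]
      have hceil : ⌈(Q : ℝ) * t⌉ = (j : ℤ) + 1 := by
        rw [Int.ceil_eq_iff]
        have h5 := (div_lt_iff₀ hQ0).1 hcell.1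
        have h6 := (le_div_iff₀ hQ0).1 hcell.2
        push_cast
        constructor <;> linarith
      simp only [g, he, hceil]
      omega
    have hmem : ∀ i ∈ Finset.range M, (m, i) ∈ Finset.Icc 1 M ×ˢ Finset.range M := fun i hi =>
      Finset.mem_product.2 ⟨hs hms, hi⟩
    rw [abs_lt] at hax hya
    rw [Finset.mem_union, Finset.mem_image, Finset.mem_image]
    by_cases hlow : -ρ m < m * y - a
    · have hup : ρ m ≤ m * y - a := not_lt.1 fun h => hya ⟨hlow, h⟩
      obtain ⟨i, hi, hgi⟩ := key (-ρ m) ((a + ρ m) / m) (by field_simp; ring) (by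
        constructor
        · refine hx.1.trans ?_
          rw [lt_div_iff₀ hm0]; linarith
        · refine le_trans ?_ hy.2
          rw [div_le_iff₀ hm0]; linarith)
      exact Or.inl ⟨(m, i), hmem i hi, hgi⟩
    · obtain ⟨i, hi, hgi⟩ := key (ρ m) ((a - ρ m) / m) (by field_simp) (by
        constructor
        · refine hy.1.trans_le ?_
          rw [le_div_iff₀ hm0]; linarith
        · refine le_trans ?_ hx.2
          rw [div_le_iff₀ hm0]; linarith)
      exact Or.inr ⟨(m, i), hmem i hi, hgi⟩
  refine (Finset.card_le_card hsub).trans ((Finset.card_union_le _ _).trans ?_)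
  have hcard : (Finset.Icc 1 M ×ˢ Finset.range M).card = M ^ 2 := by simp [sq]
  have h1 := Finset.card_image_le (s := Finset.Icc 1 M ×ˢ Finset.range M)
    (f := fun z => g (e (-ρ z.1) z))
  have h2 := Finset.card_image_le (s := Finset.Icc 1 M ×ˢ Finset.range M)
    (f := fun z => g (e (ρ z.1) z))
  omega

/-- `nearReduced n r` is equidistributed, up to a constant, in the complement `U` of the sets with
much smaller denominators: `U` is essentially a union of cells of length `1 / Q`. -/
theorem measure_compl_inter_ge {M Q n : ℕ} (hQ : Q ≠ 0) (ρ : ℕ → ℝ) (s : Finset ℕ)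
    (hs : s ⊆ Finset.Icc 1 M) {δ : ℝ}
    (hδ : δ ≤ unitMeasure.real (⋃ m ∈ s, nearReduced m (ρ m))ᶜ)
    (hMQ : 4 * (M : ℝ) ^ 2 ≤ Q * δ) {r : ℝ} (hr0 : 0 ≤ r) (hr : r ≤ 1 / 2)
    (hnQ : 2 * Q * (3 + 2 * Real.sqrt n) ≤ n.totient) :
    δ / 2 * (r * n.totient / n) ≤
      unitMeasure.real ((⋃ m ∈ s, nearReduced m (ρ m))ᶜ ∩ nearReduced n r) := by
  classical
  have hQ0 : (0 : ℝ) < Q := by exact_mod_cast Nat.pos_of_ne_zero hQ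
  set V : Set ℝ := ⋃ m ∈ s, nearReduced m (ρ m) with hV
  have hVo : IsOpen V := isOpen_biUnion fun m _ => isOpen_nearReduced m _
  let cell : ℕ → Set ℝ := fun j => Set.Ioc ((j : ℝ) / Q) ((j + 1 : ℝ) / Q)
  have hcellvol : ∀ j, volume.real (cell j) = 1 / Q := by
    intro j
    rw [Real.volume_real_Ioc_of_le (by gcongr; linarith)]
    ring
  have hcellsub : ∀ j < Q, cell j ⊆ Set.Ioc 0 1 := by
    intro j hj
    refine Set.Ioc_subset_Ioc (by positivity) ?_
    rw [div_le_one hQ0]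
    exact_mod_cast hj
  let J := (Finset.range Q).filter fun j => cell j ⊆ Vᶜ
  let B := (Finset.range Q).filter fun j => (∃ x ∈ cell j, x ∈ V) ∧ ∃ y ∈ cell j, y ∉ V
  have hBcard : B.card ≤ 2 * M ^ 2 := by
    refine card_mixed_cells_le hQ ρ s hs B fun j hj => ?_
    obtain ⟨h1, ⟨x, hx, hxV⟩, y, hy, hyV⟩ := Finset.mem_filter.1 hj
    exact ⟨Finset.mem_range.1 h1, x, hx, y, hy, hxV, hyV⟩
  have hcover : Vᶜ ∩ Set.Ioc 0 1 ⊆ ⋃ j ∈ J ∪ B, cell j := by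
    rintro x ⟨hxV, hx0, hx1⟩
    have hc0 : 0 < ⌈(Q : ℝ) * x⌉₊ := Nat.ceil_pos.2 (by positivity)
    have hc1 : ⌈(Q : ℝ) * x⌉₊ ≤ Q := Nat.ceil_le.2 (by nlinarith)
    obtain ⟨j, hj⟩ : ∃ j, ⌈(Q : ℝ) * x⌉₊ = j + 1 := ⟨⌈(Q : ℝ) * x⌉₊ - 1, by omega⟩
    have hjQ : j < Q := by omega
    have hxj : x ∈ cell j := by
      have h1 := Nat.le_ceil ((Q : ℝ) * x)
      have h2 := Nat.ceil_lt_add_one (show 0 ≤ (Q : ℝ) * x by positivity)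
      rw [hj] at h1 h2
      push_cast at h1 h2
      constructor
      · rw [div_lt_iff₀ hQ0]; linarith
      · rw [le_div_iff₀ hQ0]; linarith
    simp only [Set.mem_iUnion]
    refine ⟨j, ?_, hxj⟩
    rw [Finset.mem_union]
    by_cases h : cell j ⊆ Vᶜ
    · exact Or.inl (Finset.mem_filter.2 ⟨Finset.mem_range.2 hjQ, h⟩)
    · obtain ⟨z, hz, hzV⟩ := Set.not_subset.1 h
      exact Or.inr (Finset.mem_filter.2 ⟨Finset.mem_range.2 hjQ,
        ⟨z, hz, not_not.1 hzV⟩, x, hxj, hxV⟩)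
  have hcellfin : ∀ j, volume (cell j) ≠ ⊤ := fun j => by simp [cell]
  have hδJ : δ ≤ (J.card + 2 * (M : ℝ) ^ 2) / Q := by
    calc δ ≤ volume.real (Vᶜ ∩ Set.Ioc 0 1) := by
          rw [measureReal_restrict_apply hVo.measurableSet.compl] at hδ; exact hδ
      _ ≤ volume.real (⋃ j ∈ J ∪ B, cell j) := measureReal_mono hcover
          (measure_biUnion_lt_top (Finset.finite_toSet _)
            fun j _ => lt_top_iff_ne_top.2 (hcellfin j)).ne
      _ ≤ ∑ j ∈ J ∪ B, volume.real (cell j) := measureReal_biUnion_finset_le _ _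
      _ = ((J ∪ B).card : ℝ) / Q := by
          rw [Finset.sum_congr rfl fun j _ => hcellvol j, Finset.sum_const, nsmul_eq_mul,
            mul_one_div]
      _ ≤ _ := by
          gcongr
          have := Finset.card_union_le J B
          exact_mod_cast this.trans (by omega : J.card + B.card ≤ J.card + 2 * M ^ 2)
  have hJ : δ / 2 * Q ≤ J.card := by
    rw [le_div_iff₀ hQ0] at hδJ
    linarith
  have hdisj : (J : Set ℕ).PairwiseDisjoint fun j => nearReduced n r ∩ cell j := by
    intro i _ j _ hij
    refine Set.disjoint_left.2 fun x hx hy => hij ?_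
    have h1 := (div_lt_iff₀ hQ0).1 hx.2.1
    have h2 := (le_div_iff₀ hQ0).1 hx.2.2
    have h3 := (div_lt_iff₀ hQ0).1 hy.2.1
    have h4 := (le_div_iff₀ hQ0).1 hy.2.2
    have h5 : (i : ℝ) < j + 1 := by linarith
    have h6 : (j : ℝ) < i + 1 := by linarith
    have h5' : i < j + 1 := by exact_mod_cast h5
    have h6' : j < i + 1 := by exact_mod_cast h6
    omega
  calc δ / 2 * (r * n.totient / n) = δ / 2 * Q * (r * n.totient / n / Q) := by field_simp
    _ ≤ J.card * (r * n.totient / n / Q) := by gcongr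
    _ = ∑ j ∈ J, r * n.totient / n / Q := by rw [Finset.sum_const, nsmul_eq_mul]
    _ ≤ ∑ j ∈ J, volume.real (nearReduced n r ∩ cell j) :=
        Finset.sum_le_sum fun j _ => measure_nearReduced_cell_ge hQ hr0 hr hnQ j
    _ = volume.real (⋃ j ∈ J, nearReduced n r ∩ cell j) := by
        refine (measureReal_biUnion_finset hdisj
          (fun j _ => (isOpen_nearReduced n r).measurableSet.inter measurableSet_Ioc)
          (fun j _ => ?_)).symm
        exact ((measure_mono Set.inter_subset_right).trans_lt
          (lt_top_iff_ne_top.2 (hcellfin j))).ne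
    _ ≤ volume.real (Vᶜ ∩ nearReduced n r ∩ Set.Ioc 0 1) := by
        refine measureReal_mono (fun x hx => ?_)
          ((measure_mono Set.inter_subset_right).trans_lt (by simp)).ne
        simp only [Set.mem_iUnion] at hx
        obtain ⟨j, hj, hxn, hxj⟩ := hx
        obtain ⟨hjQ, hjV⟩ := Finset.mem_filter.1 hj
        exact ⟨⟨hjV hxj, hxn⟩, hcellsub j (Finset.mem_range.1 hjQ) hxj⟩
    _ = _ := by
        rw [measureReal_restrict_apply
          (hVo.measurableSet.compl.inter (isOpen_nearReduced n r).measurableSet)]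

/-- Bonferroni's inequality. -/
theorem sum_sub_sum_inter_le_measureReal_biUnion {α ι : Type*} [MeasurableSpace α] [DecidableEq ι]
    (μ : Measure α) [IsFiniteMeasure μ] (s : Finset ι) (A : ι → Set α)
    (hA : ∀ i ∈ s, MeasurableSet (A i)) :
    ∑ i ∈ s, μ.real (A i) - ∑ i ∈ s, ∑ j ∈ s.erase i, μ.real (A i ∩ A j) ≤
      μ.real (⋃ i ∈ s, A i) := by
  induction s using Finset.induction_on with
  | empty => simp
  | insert k s hk ih =>
    have ih' := ih fun i hi => hA i (Finset.mem_insert_of_mem hi)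
    rw [Finset.set_biUnion_insert, Finset.sum_insert hk, Finset.sum_insert hk,
      Finset.erase_insert hk]
    have h1 := measureReal_union_add_inter (μ := μ) (s := A k)
      (s.measurableSet_biUnion fun i hi => hA i (Finset.mem_insert_of_mem hi))
      (measure_ne_top _ _) (measure_ne_top _ _)
    have h2 : μ.real (A k ∩ ⋃ i ∈ s, A i) ≤ ∑ i ∈ s, μ.real (A k ∩ A i) := by
      rw [Set.inter_iUnion₂]
      exact measureReal_biUnion_finset_le _ _
    have h3 : ∑ i ∈ s, ∑ j ∈ s.erase i, μ.real (A i ∩ A j) ≤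
        ∑ i ∈ s, ∑ j ∈ (insert k s).erase i, μ.real (A i ∩ A j) :=
      Finset.sum_le_sum fun i _ => Finset.sum_le_sum_of_subset_of_nonneg
        (Finset.erase_subset_erase _ (Finset.subset_insert _ _)) fun _ _ _ => measureReal_nonneg
    linarith

/-! ### Passing between the circle and the real line -/

theorem preimage_E (ψ : ℕ → ℝ) {n : ℕ} (hn : n ≠ 0) :
    (fun x : ℝ => (x : AddCircle (1 : ℝ))) ⁻¹' E ψ n = nearReduced n (ψ n) := by
  have hn0 : (0 : ℤ) < n := by exact_mod_cast Nat.pos_of_ne_zero hn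
  ext x
  simp only [E, Set.mem_preimage, Set.mem_iUnion, Set.mem_image, Set.mem_ofPred_eq, nearReduced,
    exists_prop]
  constructor
  · rintro ⟨a, ⟨-, -, ha⟩, y, hy, hyx⟩
    obtain ⟨k, hk⟩ := (AddCircle.coe_eq_zero_iff (1 : ℝ) (x := x - y)).1 (by
      rw [AddCircle.coe_sub, hyx, sub_self])
    rw [zsmul_eq_mul, mul_one] at hk
    refine ⟨a + n * k, ?_, ?_⟩
    · exact IsCoprime.add_mul_left_left (Nat.isCoprime_iff_coprime.2 ha) k
    · have h := (abs_mul_sub_lt_iff hn).2 hy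
      have : (n : ℝ) * x - ((a + n * k : ℤ) : ℝ) = n * y - a := by
        push_cast
        rw [hk]
        ring
      rwa [this]
  · rintro ⟨b, hb, hbx⟩
    set k : ℤ := (b - 1) / n with hk
    have h1 := Int.emod_add_mul_ediv (b - 1) n
    have h2 := Int.emod_nonneg (b - 1) hn0.ne'
    have h3 := Int.emod_lt_of_pos (b - 1) hn0
    obtain ⟨a, ha⟩ : ∃ a : ℕ, (a : ℤ) = (b - 1) % n + 1 :=
      ⟨((b - 1) % n + 1).toNat, Int.toNat_of_nonneg (by omega)⟩
    have hba : b = a + n * k := by rw [ha]; linarith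
    refine ⟨a, ⟨by omega, by omega, ?_⟩, x - k, ?_, ?_⟩
    · rw [hba] at hb
      exact Nat.isCoprime_iff_coprime.1 (IsCoprime.of_add_mul_left_left hb)
    · rw [← abs_mul_sub_lt_iff hn]
      have : (n : ℝ) * (x - k) - a = n * x - (b : ℝ) := by
        rw [hba]; push_cast; ring
      rwa [this]
    · rw [AddCircle.coe_sub, sub_eq_self]
      exact (AddCircle.coe_eq_zero_iff (1 : ℝ)).2 ⟨k, by simp⟩

theorem measure_circle_eq {U : Set (AddCircle (1 : ℝ))} (hU : MeasurableSet U) :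
    (volume : Measure (AddCircle (1 : ℝ))).real U =
      unitMeasure.real ((fun x : ℝ => (x : AddCircle (1 : ℝ))) ⁻¹' U) := by
  have h := (AddCircle.measurePreserving_mk (1 : ℝ) 0).measure_preimage hU.nullMeasurableSet
  rw [zero_add] at h
  simp only [measureReal_def]
  rw [← h]

theorem isOpen_E (ψ : ℕ → ℝ) (n : ℕ) : IsOpen (E ψ n) :=
  isOpen_biUnion fun _ _ => QuotientAddGroup.isOpenMap_coe _ isOpen_Ioo

/-! ### The contribution of one block -/

theorem two_le_of_mem_Δ {h n : ℕ} (hn : n ∈ Δ h) : 2 ≤ n := by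
  have h1 := (Finset.mem_Icc.1 hn).1
  have h2 : 0 < 2 ^ 2 ^ h := by positivity
  omega

/-- The absolute constant in the bound `l / φ(l) ≤ C h` for `l` up to the square of the largest
element of the block `Δ h`. -/
noncomputable def totientConst : ℝ := 4 * Real.exp 5

theorem div_totient_le_totientConst {h l : ℕ} (hh : 1 ≤ h) (hl : l ≠ 0)
    (hlh : l ≤ 2 ^ 2 ^ (h + 2)) : (l : ℝ) / l.totient ≤ totientConst * h := by
  refine (div_totient_le hl (by omega) hlh).trans ?_
  have h1 : (1 : ℝ) ≤ h := by exact_mod_cast hh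
  have h2 := Real.exp_pos 5
  rw [totientConst]
  push_cast
  nlinarith

theorem mul_le_of_mem_Δ {h m n : ℕ} (hm : m ∈ Δ h) (hn : n ∈ Δ h) : m * n ≤ 2 ^ 2 ^ (h + 2) := by
  have h1 := (Finset.mem_Icc.1 hm).2
  have h2 := (Finset.mem_Icc.1 hn).2
  calc m * n ≤ 2 ^ 2 ^ (h + 1) * 2 ^ 2 ^ (h + 1) := Nat.mul_le_mul h1 h2
    _ = 2 ^ 2 ^ (h + 2) := by rw [← pow_add]; congr 1; ring

/-- If the radii `r` have been scaled down so that the block sum is at most `κ / h` with `κ` small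
in terms of `δ`, overlaps inside the block are negligible. -/
theorem measure_block_ge {h M Q : ℕ} (hh : 1 ≤ h) (hQ : Q ≠ 0) (ρ : ℕ → ℝ) (s : Finset ℕ)
    (hs : s ⊆ Finset.Icc 1 M) {δ : ℝ} (hδ1 : δ ≤ 1)
    (hδ : δ ≤ unitMeasure.real (⋃ m ∈ s, nearReduced m (ρ m))ᶜ)
    (hMQ : 4 * (M : ℝ) ^ 2 ≤ Q * δ)
    (hnQ : ∀ n ∈ Δ h, 2 * Q * (3 + 2 * Real.sqrt n) ≤ n.totient)
    (r : ℕ → ℝ) (hr : ∀ n ∈ Δ h, 0 ≤ r n)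
    (hS : S r h * (128 * totientConst * h) ≤ δ) :
    δ / 4 * S r h ≤ unitMeasure.real ((⋃ m ∈ s, nearReduced m (ρ m))ᶜ ∩
      ⋃ n ∈ Δ h, nearReduced n (r n)) := by
  set V : Set ℝ := ⋃ m ∈ s, nearReduced m (ρ m) with hV
  have hVm : MeasurableSet V := (isOpen_biUnion fun m _ => isOpen_nearReduced m _).measurableSet
  have hC0 : 0 < totientConst := by rw [totientConst]; positivity
  have hh0 : (0 : ℝ) < h := by exact_mod_cast hh
  set w : ℕ → ℝ := fun n => r n * n.totient / n with hw
  have hw0 : ∀ n ∈ Δ h, 0 ≤ w n := fun n hn => by have := hr n hn; positivity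
  have hSw : S r h = ∑ n ∈ Δ h, w n := rfl
  have hS0 : 0 ≤ S r h := Finset.sum_nonneg hw0
  have hwS : ∀ n ∈ Δ h, w n ≤ S r h := fun n hn => Finset.single_le_sum hw0 hn
  have hr2 : ∀ n ∈ Δ h, r n ≤ 1 / 2 := by
    intro n hn
    have hn2 := two_le_of_mem_Δ hn
    have hn0 : (0 : ℝ) < n := by positivity
    have hφ : (0 : ℝ) < n.totient := by exact_mod_cast Nat.totient_pos.2 (by omega)
    have h1 := div_totient_le_totientConst hh (l := n) (by omega)
      ((Nat.le_mul_of_pos_left n (by omega)).trans (mul_le_of_mem_Δ hn hn))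
    have h2 : r n = w n * (n / n.totient) := by rw [hw]; field_simp
    calc r n = w n * (n / n.totient) := h2
      _ ≤ S r h * (totientConst * h) := by
          gcongr
          exact hwS n hn
      _ ≤ 1 / 2 := by nlinarith
  have hbon := sum_sub_sum_inter_le_measureReal_biUnion unitMeasure (Δ h)
    (fun n => Vᶜ ∩ nearReduced n (r n))
    (fun n _ => hVm.compl.inter (isOpen_nearReduced n _).measurableSet)
  rw [Set.inter_iUnion₂]
  refine le_trans ?_ hbon
  have hmain : δ / 2 * S r h ≤ ∑ n ∈ Δ h, unitMeasure.real (Vᶜ ∩ nearReduced n (r n)) := by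
    rw [hSw, Finset.mul_sum]
    exact Finset.sum_le_sum fun n hn =>
      measure_compl_inter_ge hQ ρ s hs hδ hMQ (hr n hn) (hr2 n hn) (hnQ n hn)
  have hpairs : ∑ m ∈ Δ h, ∑ n ∈ (Δ h).erase m,
      unitMeasure.real (Vᶜ ∩ nearReduced m (r m) ∩ (Vᶜ ∩ nearReduced n (r n))) ≤
      32 * (totientConst * h) * (S r h * S r h) := by
    have : ∀ m ∈ Δ h, ∀ n ∈ (Δ h).erase m,
        unitMeasure.real (Vᶜ ∩ nearReduced m (r m) ∩ (Vᶜ ∩ nearReduced n (r n))) ≤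
        32 * (totientConst * h) * (w m * w n) := by
      intro m hm n hn
      obtain ⟨hnm, hn⟩ := Finset.mem_erase.1 hn
      refine (measureReal_mono
        (Set.inter_subset_inter Set.inter_subset_right Set.inter_subset_right)).trans
        ((measure_inter_le (two_le_of_mem_Δ hm) (two_le_of_mem_Δ hn) hnm.symm (hr m hm) (hr2 m hm)
          (hr n hn) (hr2 n hn) fun l hl hlmn => div_totient_le_totientConst hh hl
            (hlmn.trans (mul_le_of_mem_Δ hm hn))).trans_eq ?_)
      rw [hw]; ring
    calc _ ≤ ∑ m ∈ Δ h, ∑ n ∈ (Δ h).erase m, 32 * (totientConst * h) * (w m * w n) :=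
          Finset.sum_le_sum fun m hm => Finset.sum_le_sum fun n hn => this m hm n hn
      _ ≤ ∑ m ∈ Δ h, ∑ n ∈ Δ h, 32 * (totientConst * h) * (w m * w n) := by
          refine Finset.sum_le_sum fun m hm => Finset.sum_le_sum_of_subset_of_nonneg
            (Finset.erase_subset _ _) fun n hn _ => ?_
          have := hw0 m hm
          have := hw0 n hn
          positivity
      _ = _ := by
          rw [hSw, Finset.sum_mul_sum]
          simp_rw [Finset.mul_sum]
  nlinarith

/-- The growth condition that makes the earlier blocks negligible against `Δ h`: with
`M = 2 ^ 2 ^ (h - 3)`, every `n ∈ Δ h` exceeds `M ^ 8`. -/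
theorem le_totient_of_mem_Δ {i n : ℕ} (hn : n ∈ Δ (i + 3))
    (hM : 10 * totientConst * (i + 3 : ℕ) ≤ ((2 ^ 2 ^ i : ℕ) : ℝ)) :
    2 * (((2 ^ 2 ^ i) ^ 3 : ℕ) : ℝ) * (3 + 2 * Real.sqrt n) ≤ n.totient := by
  have hn2 := two_le_of_mem_Δ hn
  have hn0 : (0 : ℝ) < n := by positivity
  have hφ : (0 : ℝ) < n.totient := by exact_mod_cast Nat.totient_pos.2 (by omega)
  have hbound := div_totient_le_totientConst (h := i + 3) (by omega) (l := n) (by omega)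
    ((Nat.le_mul_of_pos_left n (by omega)).trans (mul_le_of_mem_Δ hn hn))
  set M : ℕ := 2 ^ 2 ^ i with hMdef
  have hM8 : M ^ 8 ≤ n := by
    have h1 := (Finset.mem_Icc.1 hn).1
    have h2 : M ^ 8 = 2 ^ 2 ^ (i + 3) := by rw [hMdef, ← pow_mul]; congr 1; ring
    omega
  have hsq : (M : ℝ) ^ 4 ≤ Real.sqrt n := by
    apply Real.le_sqrt_of_sq_le
    rw [← pow_mul]
    exact_mod_cast hM8
  have hM1 : (1 : ℝ) ≤ M := by exact_mod_cast Nat.one_le_two_pow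
  have hsq1 : 1 ≤ Real.sqrt n := le_trans (one_le_pow₀ hM1) hsq
  have hss : Real.sqrt n * Real.sqrt n = n := Real.mul_self_sqrt hn0.le
  have hC0 : 0 < totientConst * ((i + 3 : ℕ) : ℝ) := by
    have := Real.exp_pos 5
    rw [totientConst]; positivity
  have h1 : (n : ℝ) ≤ totientConst * (i + 3 : ℕ) * n.totient := (div_le_iff₀ hφ).1 hbound
  have h2 : totientConst * (i + 3 : ℕ) * (2 * ((M ^ 3 : ℕ) : ℝ) * (3 + 2 * Real.sqrt n)) ≤ n := by
    calc _ ≤ totientConst * (i + 3 : ℕ) * (2 * ((M ^ 3 : ℕ) : ℝ) * (5 * Real.sqrt n)) := by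
          gcongr; linarith
      _ = 10 * totientConst * (i + 3 : ℕ) * (M : ℝ) ^ 3 * Real.sqrt n := by push_cast; ring
      _ ≤ M * (M : ℝ) ^ 3 * Real.sqrt n := by gcongr
      _ = (M : ℝ) ^ 4 * Real.sqrt n := by ring
      _ ≤ Real.sqrt n * Real.sqrt n := by gcongr
      _ = n := hss
  exact le_of_mul_le_mul_left (h2.trans h1) hC0

theorem exists_forall_le_two_pow_two_pow (x : ℝ) :
    ∃ i₀ : ℕ, ∀ i ≥ i₀, x ≤ ((2 ^ 2 ^ i : ℕ) : ℝ) ∧ x * (i + 3 : ℕ) ≤ ((2 ^ 2 ^ i : ℕ) : ℝ) := by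
  refine ⟨⌈4 * |x|⌉₊ + 1, fun i hi => ?_⟩
  have hi1 : 1 ≤ i := by omega
  have hx4 : 4 * |x| ≤ i := by
    refine (Nat.le_ceil _).trans ?_
    exact_mod_cast (by omega : ⌈4 * |x|⌉₊ ≤ i)
  have hxa := le_abs_self x
  have hx0 := abs_nonneg x
  have hpow : i + 1 ≤ 2 ^ i := Nat.lt_two_pow_self
  have h2i : 2 * i ≤ 2 ^ i := by
    obtain ⟨j, rfl⟩ : ∃ j, i = j + 1 := ⟨i - 1, by omega⟩
    have : j + 1 ≤ 2 ^ j := Nat.lt_two_pow_self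
    rw [pow_succ]
    omega
  have hMN : (i + 1) * (i + 1) ≤ 2 ^ 2 ^ i := by
    calc (i + 1) * (i + 1) ≤ 2 ^ i * 2 ^ i := Nat.mul_le_mul hpow hpow
      _ = 2 ^ (2 * i) := by rw [← pow_add]; congr 1; ring
      _ ≤ 2 ^ 2 ^ i := Nat.pow_le_pow_right (by norm_num) h2i
  have hM : ((i : ℝ) + 1) * (i + 1) ≤ ((2 ^ 2 ^ i : ℕ) : ℝ) := by exact_mod_cast hMN
  have hi0 : (0 : ℝ) ≤ i := by positivity
  constructor
  · nlinarith
  · refine le_trans ?_ hM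
    push_cast
    nlinarith

/-! ### Summing over the blocks -/

/-- If sets more than three indices apart are disjoint, then their measures sum to at most `4`. -/
theorem sum_measureReal_le_four {α : Type*} [MeasurableSpace α] (μ : Measure α)
    [IsProbabilityMeasure μ] (D : ℕ → Set α) (hD : ∀ h, MeasurableSet (D h)) (s : Finset ℕ)
    (hdisj : ∀ g ∈ s, ∀ h ∈ s, g + 4 ≤ h → Disjoint (D g) (D h)) :
    ∑ h ∈ s, μ.real (D h) ≤ 4 := by
  rw [← Finset.sum_fiberwise_of_maps_to (t := Finset.range 4) (g := fun h => h % 4)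
    fun h _ => Finset.mem_range.2 (Nat.mod_lt h (by norm_num))]
  calc _ ≤ ∑ i ∈ Finset.range 4, (1 : ℝ) := by
        refine Finset.sum_le_sum fun i _ => ?_
        rw [← measureReal_biUnion_finset (μ := μ) ?_ fun h _ => hD h]
        · exact measureReal_le_one
        · intro g hg h hh hgh
          obtain ⟨hgs, hgi⟩ := Finset.mem_filter.1 (Finset.mem_coe.1 hg)
          obtain ⟨hhs, hhi⟩ := Finset.mem_filter.1 (Finset.mem_coe.1 hh)
          rcases lt_or_gt_of_ne hgh with hlt | hlt
          · exact hdisj g hgs h hhs (by omega)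
          · exact (hdisj h hhs g hgs (by omega)).symm
    _ = 4 := by simp

/-- If the tail union `⋃_{n > N} E ψ n` is not of full measure, each late block adds to the earlier
ones a set of measure comparable to `min (S ψ h) (1 / h)`, and these new parts have bounded
overlap; so the series converges. -/
theorem exists_sum_min_le (ψ : ℕ → ℝ) (hψ : ∀ n : ℕ, 1 ≤ n → 0 ≤ ψ n) (N : ℕ)
    (hN : (volume : Measure (AddCircle (1 : ℝ))).real (⋃ n, ⋃ _ : N + 1 ≤ n, E ψ n) < 1) :
    ∃ (h₀ : ℕ) (C : ℝ), ∀ H,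
      ∑ h ∈ Finset.Ioc h₀ H, min (S ψ h) (1 / (h : ℝ)) ≤ C := by
  have hopen : IsOpen (⋃ n, ⋃ _ : N + 1 ≤ n, E ψ n) :=
    isOpen_iUnion fun n => isOpen_iUnion fun _ => isOpen_E ψ n
  rw [measure_circle_eq hopen.measurableSet] at hN
  set Y : Set ℝ := (fun x : ℝ => (x : AddCircle (1 : ℝ))) ⁻¹' (⋃ n, ⋃ _ : N + 1 ≤ n, E ψ n) with hY
  have hYm : MeasurableSet Y :=
    (hopen.preimage (AddCircle.continuous_mk' (1 : ℝ))).measurableSet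
  have hYc : unitMeasure.real Yᶜ = 1 - unitMeasure.real Y := probReal_compl_eq_one_sub hYm
  set δ : ℝ := unitMeasure.real Yᶜ with hδdef
  have hδ0 : 0 < δ := by linarith
  have hδ1 : δ ≤ 1 := measureReal_le_one
  have hC0 : 0 < totientConst := by rw [totientConst]; positivity
  set κ : ℝ := δ / (128 * totientConst) with hκ
  have hκ0 : 0 < κ := by positivity
  have hC1 : 1 ≤ totientConst := by
    have := Real.add_one_le_exp 5; rw [totientConst]; linarith
  have hκ1 : κ ≤ 1 := by
    rw [hκ, div_le_one (by positivity)]; linarith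
  -- The earlier blocks, at distance at least `4`.
  let P : ℕ → Finset ℕ := fun h => (Finset.Icc N (h - 4)).biUnion Δ
  let V : ℕ → Set ℝ := fun h => ⋃ m ∈ P h, nearReduced m (ψ m)
  have hVo : ∀ h, IsOpen (V h) := fun h => isOpen_biUnion fun m _ => isOpen_nearReduced m _
  have hVY : ∀ h, V h ⊆ Y := by
    intro h x hx
    simp only [V, P, Set.mem_iUnion, Finset.mem_biUnion] at hx
    obtain ⟨m, ⟨g, hg, hm⟩, hxm⟩ := hx
    have hgN := (Finset.mem_Icc.1 hg).1
    have h1 := (Finset.mem_Icc.1 hm).1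
    have h2 : g < 2 ^ g := Nat.lt_two_pow_self
    have h3 : 2 ^ g < 2 ^ 2 ^ g := Nat.lt_two_pow_self
    rw [hY]
    simp only [Set.mem_preimage, Set.mem_iUnion]
    refine ⟨m, by omega, ?_⟩
    rw [← preimage_E ψ (by omega)] at hxm
    exact hxm
  have hVδ : ∀ h, δ ≤ unitMeasure.real (V h)ᶜ := fun h =>
    measureReal_mono (Set.compl_subset_compl.2 (hVY h))
  -- The block `Δ h` is scaled down so that its sum becomes `min (S ψ h) (κ / h)`.
  let t : ℕ → ℝ := fun h => min 1 (κ / (h * S ψ h))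
  let r : ℕ → ℕ → ℝ := fun h n => t h * ψ n
  let D : ℕ → Set ℝ := fun h => (V h)ᶜ ∩ ⋃ n ∈ Δ h, nearReduced n (r h n)
  have hDm : ∀ h, MeasurableSet (D h) := fun h => (hVo h).measurableSet.compl.inter
    (isOpen_biUnion fun n _ => isOpen_nearReduced n _).measurableSet
  have hψΔ : ∀ h, ∀ n ∈ Δ h, 0 ≤ ψ n := fun h n hn => hψ n (by have := two_le_of_mem_Δ hn; omega)
  have hS0 : ∀ h, 0 ≤ S ψ h := fun h => Finset.sum_nonneg fun n hn => by
    have := hψΔ h n hn; positivity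
  have ht0 : ∀ h, 0 ≤ t h := fun h => le_min zero_le_one (by have := hS0 h; positivity)
  have hrψ : ∀ h, ∀ n ∈ Δ h, r h n ≤ ψ n := fun h n hn =>
    mul_le_of_le_one_left (hψΔ h n hn) (min_le_left _ _)
  have hSr : ∀ h, S (r h) h = t h * S ψ h := by
    intro h
    simp only [S, r, Finset.mul_sum]
    exact Finset.sum_congr rfl fun n _ => by ring
  obtain ⟨i₀, hi₀⟩ := exists_forall_le_two_pow_two_pow (10 * totientConst + 4 / δ)
  refine ⟨max (i₀ + 3) (N + 4), 4 / (κ * δ / 4), fun H => ?_⟩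
  have hblock : ∀ h ∈ Finset.Ioc (max (i₀ + 3) (N + 4)) H,
      κ * δ / 4 * min (S ψ h) (1 / (h : ℝ)) ≤ unitMeasure.real (D h) := by
    intro h hh
    rw [Finset.mem_Ioc, max_lt_iff] at hh
    have hh0 : (0 : ℝ) < h := by exact_mod_cast (by omega : 0 < h)
    obtain ⟨i, rfl⟩ : ∃ i, h = i + 3 := ⟨h - 3, by omega⟩
    obtain ⟨hM1, hM2⟩ := hi₀ i (by omega)
    rcases (hS0 (i + 3)).eq_or_lt with hS | hS
    · rw [← hS, min_eq_left (by positivity), mul_zero]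
      exact measureReal_nonneg
    set M : ℕ := 2 ^ 2 ^ i with hMdef
    have h4δ : 0 < 4 / δ := by positivity
    have hM0 : (0 : ℝ) < M := by exact_mod_cast Nat.two_pow_pos _
    have hP : P (i + 3) ⊆ Finset.Icc 1 M := by
      intro m hm
      obtain ⟨g, hg, hmg⟩ := Finset.mem_biUnion.1 hm
      have h1 := (Finset.mem_Icc.1 hg).2
      have h2 := (Finset.mem_Icc.1 hmg).2
      have h3 := two_le_of_mem_Δ hmg
      refine Finset.mem_Icc.2 ⟨by omega, h2.trans ?_⟩
      exact Nat.pow_le_pow_right (by norm_num) (Nat.pow_le_pow_right (by norm_num) (by omega))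
    have hMQ : 4 * (M : ℝ) ^ 2 ≤ ((M ^ 3 : ℕ) : ℝ) * δ := by
      have h1 : 4 / δ ≤ M := by linarith
      rw [div_le_iff₀ hδ0] at h1
      push_cast
      nlinarith [sq_nonneg (M : ℝ)]
    have hσ : S (r (i + 3)) (i + 3) = min (S ψ (i + 3)) (κ / (i + 3 : ℕ)) := by
      rw [hSr, min_mul_of_nonneg _ _ hS.le, one_mul]
      congr 1
      field_simp
    have hmain := measure_block_ge (h := i + 3) (M := M) (Q := M ^ 3) (by omega) (by positivity)
      ψ (P (i + 3)) hP hδ1 (hVδ _) hMQ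
      (fun n hn => le_totient_of_mem_Δ hn (by
        refine le_trans ?_ hM2
        gcongr
        linarith))
      (r (i + 3)) (fun n hn => mul_nonneg (ht0 _) (hψΔ _ n hn)) (by
        rw [hσ]
        calc _ ≤ κ / (i + 3 : ℕ) * (128 * totientConst * (i + 3 : ℕ)) := by
              gcongr; exact min_le_right _ _
          _ = δ := by rw [hκ]; field_simp)
    refine le_trans ?_ hmain
    rw [hσ]
    have hmin : κ * min (S ψ (i + 3)) (1 / ((i + 3 : ℕ) : ℝ)) ≤
        min (S ψ (i + 3)) (κ / (i + 3 : ℕ)) := by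
      refine le_min ?_ ?_
      · calc _ ≤ 1 * S ψ (i + 3) := by
              gcongr
              exact min_le_left _ _
          _ = _ := one_mul _
      · calc _ ≤ κ * (1 / ((i + 3 : ℕ) : ℝ)) := by gcongr; exact min_le_right _ _
          _ = _ := by ring
    calc _ = δ / 4 * (κ * min (S ψ (i + 3)) (1 / ((i + 3 : ℕ) : ℝ))) := by ring
      _ ≤ _ := by gcongr
  have hsum := sum_measureReal_le_four unitMeasure D hDm (Finset.Ioc (max (i₀ + 3) (N + 4)) H) (by
    intro g hg h _ hgh
    rw [Finset.mem_Ioc, max_lt_iff] at hg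
    refine Set.disjoint_left.2 fun x hxg hxh => hxh.1 ?_
    have hxg2 := hxg.2
    simp only [V, P, Set.mem_iUnion, Finset.mem_biUnion] at hxg2 ⊢
    obtain ⟨n, hn, hxn⟩ := hxg2
    exact ⟨n, ⟨g, Finset.mem_Icc.2 ⟨by omega, by omega⟩, hn⟩,
      nearReduced_mono n (hrψ g n hn) hxn⟩)
  rw [le_div_iff₀ (by positivity), mul_comm, Finset.mul_sum]
  exact (Finset.sum_le_sum hblock).trans hsum

theorem volume_W_eq_one (ψ : ℕ → ℝ) (hψ : ∀ n : ℕ, 1 ≤ n → 0 ≤ ψ n)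
    (hdiv : Tendsto
      (fun H : ℕ => ∑ h ∈ Finset.Icc 1 H, min (S ψ h) (1 / (h : ℝ)))
      atTop atTop) :
    (volume : Measure (AddCircle (1 : ℝ))) (W ψ) = 1 := by
  have huniv : (volume : Measure (AddCircle (1 : ℝ))) Set.univ = 1 := by
    simp [AddCircle.measure_univ]
  have : IsProbabilityMeasure (volume : Measure (AddCircle (1 : ℝ))) := ⟨huniv⟩
  set Y : ℕ → Set (AddCircle (1 : ℝ)) := fun N => ⋃ n, ⋃ _ : N + 1 ≤ n, E ψ n with hY
  have hW : W ψ = ⋂ N, Y N := by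
    ext x
    simp only [W, hY, Set.mem_iInter]
    constructor
    · exact fun h N => h (N + 1) (by omega)
    · intro h N hN
      obtain ⟨M, rfl⟩ : ∃ M, N = M + 1 := ⟨N - 1, by omega⟩
      exact h M
  have hfull : ∀ N, (volume : Measure (AddCircle (1 : ℝ))) (Y N) = 1 := by
    intro N
    by_contra hne
    have hlt : (volume : Measure (AddCircle (1 : ℝ))).real (Y N) < 1 := by
      refine lt_of_le_of_ne measureReal_le_one fun h => hne ?_
      rw [measureReal_def] at h
      rw [← ENNReal.ofReal_toReal (measure_ne_top volume (Y N)), h, ENNReal.ofReal_one]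
    obtain ⟨h₀, C, hC⟩ := exists_sum_min_le ψ hψ N hlt
    obtain ⟨H, hH, hHC⟩ := ((tendsto_atTop.1 hdiv
      (∑ h ∈ Finset.Icc 1 h₀, min (S ψ h) (1 / (h : ℝ)) + C + 1)).and
      (eventually_ge_atTop h₀)).exists
    have hsplit : Finset.Icc 1 H = Finset.Icc 1 h₀ ∪ Finset.Ioc h₀ H := by
      ext h; simp only [Finset.mem_union, Finset.mem_Icc, Finset.mem_Ioc]; omega
    rw [hsplit, Finset.sum_union (Finset.disjoint_left.2 fun h h1 h2 => by
      rw [Finset.mem_Icc] at h1; rw [Finset.mem_Ioc] at h2; omega)] at hH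
    linarith [hC H]
  rw [hW]
  have hmeas : ∀ N, MeasurableSet (Y N) := fun N =>
    (isOpen_iUnion fun n => isOpen_iUnion fun _ => isOpen_E ψ n).measurableSet
  rw [← prob_compl_eq_zero_iff (MeasurableSet.iInter hmeas),
    Set.compl_iInter, measure_iUnion_null_iff]
  exact fun N => (prob_compl_eq_zero_iff (hmeas N)).2 (hfull N)

end DuffinSchaeffer

theorem corollary1 (ψ : ℕ → ℝ) (hψ : ∀ n : ℕ, 1 ≤ n → 0 ≤ ψ n)
    (hdiv : Tendsto
      (fun H : ℕ => ∑ h ∈ Finset.Icc 1 H, min (DuffinSchaeffer.S ψ h) (1 / (h : ℝ)))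
      atTop atTop) :
    (volume : Measure (AddCircle (1 : ℝ))) (DuffinSchaeffer.W ψ) = 1 :=
  DuffinSchaeffer.volume_W_eq_one ψ hψ hdiv
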